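/- Let $d\ge 1$, let $K$ be a finite set, and let $\mathcal A(\rho)=\sum_{k\in K}\sigma_k\operatorname{Tr}(X_k\rho)$ be an entanglement-breaking channel on $d\times d$ complex matrices, where each $\sigma_k$ is a density matrix and $(X_k)_{k\in K}$ is a POVM ($X_k\ge 0$, $\sum_k X_k=\mathbb 1$). Logarithms are to base $2$. For a channel $\mathcal C$ on a finite-dimensional space let $|\phi\rangle$ be a uniformly distributed unit vector of the input space and put $$\overline S_r(\mathcal C)=\mathbb E\Big[\tfrac1{1-r}\log\operatorname{Tr}\,\mathcal C(|\phi\rangle\langle\phi|)^r\Big],\qquad \beta_r(\mathcal C)=\tfrac1{1-r}\log\mathbb E\big[\operatorname{Tr}\,\mathcal C(|\phi\rangle\langle\phi|)^r\big]\qquad(r>1),$$ $\overline S_1(\mathcal C)=\mathbb E[-\operatorname{Tr}\rho\log\rho]$ with $\rho=\mathcal C(|\phi\rangle\langle\phi|)$, and $\beta_1(\mathcal C)=\lim_{r\downarrow1}\beta_r(\mathcal C)$. The regularizations are $$\overline S_r^{\mathrm{reg}}(\mathcal A)=\liminf_{n\to\infty}\tfrac1n\overline S_r(\mathcal A^{\otimes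 n}),\qquad \beta_r^{\mathrm{reg}}(\mathcal A)=\liminf_{n\to\infty}\tfrac1n\beta_r(\mathcal A^{\otimes n}).$$ (a) Let $r\ge2$ be an integer such that $\operatorname{Tr}\big(\prod_{i=1}^r\sigma_{k_i}\big)\ge0$ (real and nonnegative) for all $k_1,\dots,k_r\in K$. Then $$\beta_r^{\mathrm{reg}}(\mathcal A)=\lim_{n\to\infty}\tfrac1n\beta_r(\mathcal A^{\otimes n})=\tfrac1{1-r}\log\operatorname{Tr}\big(\mathcal A(\mathbb 1/d)^r\big).$$ Moreover, with $\mathcal Q_{\mathcal A,r}(\alpha)=\sum_{x_1,\dots,x_r=1}^d\operatorname{Tr}\prod_{i=1}^r\mathcal A\big(|x_i\rangle\langle x_{\alpha(i)}|\big)$ for a permutation $\alpha$ of $\{1,\dots,r\}$ (the product being taken in the order $i=1,\dots,r$), the identity permutation maximizes $|\mathcal Q_{\mathcal A,r}|$: $|\mathcal Q_{\mathcal A,r}(\alpha)|\le\mathcal Q_{\mathcal A,r}(\mathrm{id})=\operatorname{Tr}\big(\mathcal A(\mathbb 1)^r\big)$ for all $\alpha$. (b) If in addition $\mathcal A$ is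 unital, $\mathcal A(\mathbb 1)=\mathbb 1$, and $\operatorname{Tr}\big(\prod_{i=1}^m\sigma_{k_i}\big)\ge0$ for every integer $m\ge2$ and all $k_1,\dots,k_m\in K$, then for all real $r\ge1$ $$\overline S_r^{\mathrm{reg}}(\mathcal A)=\beta_r^{\mathrm{reg}}(\mathcal A)=\log d,$$ and the limit defining $\beta_1(\mathcal A^{\otimes n})$ exists for every $n$. -/

import Mathlib

open scoped ComplexOrder

noncomputable section

namespace AvgOutputEntropy

/-- Complex matrices indexed by a finite set `ι`, i.e. operators on `ℂ^ι`. -/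
abbrev Mat (ι : Type*) := Matrix ι ι ℂ

/-- A density matrix: positive semidefinite of trace one. -/
def IsDensity {ι : Type*} [Fintype ι] (ρ : Mat ι) : Prop :=
  ρ.PosSemidef ∧ ρ.trace = 1

/-- A (finite) POVM: positive semidefinite operators that sum to the identity. -/
def IsPOVM {ι K : Type*} [Fintype ι] [DecidableEq ι] [Fintype K] (X : K → Mat ι) : Prop :=
  (∀ k, (X k).PosSemidef) ∧ ∑ k, X k = 1

/-- `A` is the entanglement-breaking channel `A(ρ) = ∑ₖ σₖ Tr(Xₖ ρ)`, where the `σₖ` are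
density matrices and the `Xₖ` form a POVM. -/
structure IsEntanglementBreaking {ι K : Type*} [Fintype ι] [DecidableEq ι] [Fintype K]
    (A : Mat ι →ₗ[ℂ] Mat ι) (σ X : K → Mat ι) : Prop where
  density : ∀ k, IsDensity (σ k)
  povm : IsPOVM X
  apply_eq : ∀ ρ : Mat ι, A ρ = ∑ k, (X k * ρ).trace • σ k

/-- `Tr(σ_{k₁} σ_{k₂} ⋯ σ_{k_m}) ≥ 0` for all choices of indices. In the order of `ℂ`, being
nonnegative includes being real. -/
def TraceProdNonneg {ι K : Type*} [Fintype ι] [DecidableEq ι] (m : ℕ) (σ : K → Mat ι) : Prop :=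
  ∀ k : Fin m → K, 0 ≤ ((List.ofFn fun i => σ (k i)).prod).trace

/-- The tensor power `A^{⊗n}`, acting on the matrices over `(ℂ^ι)^{⊗n} = ℂ^(Fin n → ι)`: the linear
map that sends `⊗ᵢ |xᵢ⟩⟨yᵢ|` to `⊗ᵢ A(|xᵢ⟩⟨yᵢ|)`. -/
def tensorPower {ι : Type*} [Fintype ι] [DecidableEq ι] (A : Mat ι →ₗ[ℂ] Mat ι) (n : ℕ) :
    Mat (Fin n → ι) →ₗ[ℂ] Mat (Fin n → ι) where
  toFun M := Matrix.of fun a b =>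
    ∑ x : Fin n → ι, ∑ y : Fin n → ι,
      M x y * ∏ i, A (Matrix.single (x i) (y i) 1) (a i) (b i)
  map_add' M N := by
    ext a b
    simp [add_mul, Finset.sum_add_distrib]
  map_smul' c M := by
    ext a b
    simp [Finset.mul_sum, mul_assoc]

/-- The set of unit vectors of `ℂ^ι`. -/
abbrev UnitSphere (ι : Type*) [Fintype ι] := Metric.sphere (0 : EuclideanSpace ℂ ι) 1

/-- The uniform probability measure on the unit vectors of `ℂ^ι`: the normalized surface measure. -/
def uniform (ι : Type*) [Fintype ι] : MeasureTheory.Measure (UnitSphere ι) :=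
  ((MeasureTheory.volume : MeasureTheory.Measure (EuclideanSpace ℂ ι)).toSphere Set.univ)⁻¹ •
    (MeasureTheory.volume : MeasureTheory.Measure (EuclideanSpace ℂ ι)).toSphere

/-- The pure state `|φ⟩⟨φ|`. -/
def pureState {ι : Type*} [Fintype ι] (φ : UnitSphere ι) : Mat ι :=
  Matrix.of fun x y => (φ : EuclideanSpace ℂ ι) x * star ((φ : EuclideanSpace ℂ ι) y)

/-- `Tr f(ρ)` for a Hermitian matrix `ρ`, by the functional calculus. -/
def trFun {ι : Type*} [Fintype ι] [DecidableEq ι] (f : ℝ → ℝ) (ρ : Mat ι) : ℝ :=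
  (cfc f ρ).trace.re

/-- `Tr ρ^r` for a positive semidefinite matrix `ρ` and a real exponent `r > 0`. -/
def trPow {ι : Type*} [Fintype ι] [DecidableEq ι] (r : ℝ) (ρ : Mat ι) : ℝ :=
  trFun (fun x => x ^ r) ρ

open Classical in
/-- The Rényi entropy of order `r ≥ 1` of a density matrix, with logarithms to base 2;
for `r = 1` it is the von Neumann entropy `-Tr ρ log ρ`. -/
def renyi {ι : Type*} [Fintype ι] [DecidableEq ι] (r : ℝ) (ρ : Mat ι) : ℝ :=
  if r = 1 then trFun (fun x => -(x * Real.logb 2 x)) ρ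
  else 1 / (1 - r) * Real.logb 2 (trPow r ρ)

/-- The average output Rényi entropy of a channel over uniformly distributed pure inputs. -/
def avgEntropy {ι : Type*} [Fintype ι] [DecidableEq ι] (r : ℝ) (C : Mat ι →ₗ[ℂ] Mat ι) : ℝ :=
  ∫ φ, renyi r (C (pureState φ)) ∂(uniform ι)

/-- The average moment `𝔼 Tr C(|φ⟩⟨φ|)^r`. -/
def moment {ι : Type*} [Fintype ι] [DecidableEq ι] (r : ℝ) (C : Mat ι →ₗ[ℂ] Mat ι) : ℝ :=
  ∫ φ, trPow r (C (pureState φ)) ∂(uniform ι)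

open Classical in
/-- `β_r(C) = (1/(1-r)) log 𝔼 Tr C(|φ⟩⟨φ|)^r`; for `r = 1` this is read as the limit `r ↓ 1`. -/
def beta {ι : Type*} [Fintype ι] [DecidableEq ι] (r : ℝ) (C : Mat ι →ₗ[ℂ] Mat ι) : ℝ :=
  if r = 1 then
    Filter.limUnder (nhdsWithin 1 (Set.Ioi 1)) fun s : ℝ => 1 / (1 - s) * Real.logb 2 (moment s C)
  else 1 / (1 - r) * Real.logb 2 (moment r C)

/-- The regularized average output entropy, a `liminf` in the extended reals. -/
def avgEntropyReg {ι : Type*} [Fintype ι] [DecidableEq ι] (r : ℝ) (A : Mat ι →ₗ[ℂ] Mat ι) :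
    EReal :=
  Filter.liminf (fun n : ℕ => ((1 / (n : ℝ) * avgEntropy r (tensorPower A n) : ℝ) : EReal))
    Filter.atTop

/-- The regularization of `β_r`, a `liminf` in the extended reals. -/
def betaReg {ι : Type*} [Fintype ι] [DecidableEq ι] (r : ℝ) (A : Mat ι →ₗ[ℂ] Mat ι) : EReal :=
  Filter.liminf (fun n : ℕ => ((1 / (n : ℝ) * beta r (tensorPower A n) : ℝ) : EReal))
    Filter.atTop

/-- `Q_{A,r}(α) = ∑_{x₁,…,x_r} Tr ∏ᵢ A(|xᵢ⟩⟨x_{α(i)}|)`, the product being taken in the order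
`i = 1, …, r`. -/
def Q {ι : Type*} [Fintype ι] [DecidableEq ι] (A : Mat ι →ₗ[ℂ] Mat ι) (r : ℕ)
    (α : Equiv.Perm (Fin r)) : ℂ :=
  ∑ x : Fin r → ι, ((List.ofFn fun i => A (Matrix.single (x i) (x (α i)) 1)).prod).trace

end AvgOutputEntropy

end

/-! Write D for the input dimension of an entanglement-breaking channel C. Everything rests on
comparing the moment 𝔼 Tr C(|φ⟩⟨φ|)^r, for integer r, with Tr C(𝟙/D)^r up to a factor that does not
depend on D. Convexity gives the lower bound with factor 1 (`trace_pow_le_moment`, from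
`klein_pow`).

For the upper bound, expand Tr C(|φ⟩⟨φ|)^r = ∑ₖ ∏ᵢ ⟨φ|X_{kᵢ}|φ⟩ · Tr ∏ᵢ σ_{kᵢ}. The weights Tr ∏ σ
are nonnegative, so it is enough to bound each mean of ∏ᵢ ⟨φ|X_{kᵢ}|φ⟩ by a constant times ∏ᵢ Tr
X_{kᵢ}/D. Splitting the X's into rank-one pieces reduces this to 𝔼|⟨w,φ⟩|^{2r} ≤ r!/D^r for unit w,
a Gaussian computation; the constant is r·r! (`moment_le_trace_pow`).

Tensor powers stay in the same class, with the same trace condition, and Tr C(𝟙/D)^r is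
multiplicative. The n-th moment thus lies between Tⁿ and r·r!·Tⁿ with T = Tr A(𝟙/d)^r, and (1/n) log
removes the constant. The same expansion with Cauchy-Schwarz shows that the identity permutation
maximizes |Q| (`norm_Q_le`).

In the unital case, Jensen's inequality places both entropies of any real order r between β_m, for
an integer m ≥ max(2, r), and log D. Divided by n, both ends tend to log d. Jensen is always used as
a tangent-line inequality, affine in a trace power and hence integrable term by term. -/

noncomputable section
namespace AvgOutputEntropy
open MeasureTheory Real

/-! ### Moments of |⟨v, φ⟩|² for a uniform unit vector -/

section Sphere
variable {ι : Type*} [Fintype ι]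

/-- Off the null set {0}, the polar homeomorphism carries `μ` to a product measure, so a separable
integrand splits. With a Gaussian radial factor this recovers sphere integrals from integrals over
the whole space. -/
theorem integral_polar {E : Type*} [NormedAddCommGroup E] [NormedSpace ℝ E] [MeasurableSpace E]
    [Nontrivial E] [FiniteDimensional ℝ E] [BorelSpace E] (μ : Measure E) [μ.IsAddHaarMeasure]
    (f : Metric.sphere (0 : E) 1 → ℝ) (g : ℝ → ℝ) (F : E → ℝ)
    (hF : ∀ (s : Metric.sphere (0 : E) 1) (t : ℝ), 0 < t → F (t • (s : E)) = f s * g t) :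
    ∫ x, F x ∂μ = (∫ s, f s ∂μ.toSphere) *
      ∫ t in Set.Ioi (0 : ℝ), t ^ (Module.finrank ℝ E - 1) * g t := by
  calc
    ∫ x, F x ∂μ = ∫ x : ({(0)}ᶜ : Set E), F x.1 ∂(μ.comap (↑)) := by
      rw [integral_subtype_comap (measurableSet_singleton _).compl F, restrict_compl_singleton]
    _ = ∫ x, f x.1 * g x.2 ∂μ.toSphere.prod (.volumeIoiPow (Module.finrank ℝ E - 1)) := by
      rw [← μ.measurePreserving_homeomorphUnitSphereProd.integral_comp
        (Homeomorph.measurableEmbedding _)]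
      refine integral_congr_ae (.of_forall fun x => ?_)
      have := hF (homeomorphUnitSphereProd E x).1 (homeomorphUnitSphereProd E x).2
        (homeomorphUnitSphereProd E x).2.2
      simp only
      rw [← this]
      congr 1
      have hx : ‖(x : E)‖ ≠ 0 := norm_ne_zero_iff.2 x.2
      simp [smul_smul, hx]
    _ = (∫ s, f s ∂μ.toSphere) *
        ∫ x : Set.Ioi (0 : ℝ), g x ∂.volumeIoiPow (Module.finrank ℝ E - 1) :=
      integral_prod_mul f (fun x : Set.Ioi (0 : ℝ) => g x)
    _ = _ := by
      simp only [Measure.volumeIoiPow, ENNReal.ofReal]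
      rw [integral_withDensity_eq_integral_smul,
        integral_subtype_comap measurableSet_Ioi
          fun a ↦ Real.toNNReal (a ^ (Module.finrank ℝ E - 1)) • g a,
        setIntegral_congr_fun measurableSet_Ioi fun x hx ↦ ?_]
      · rw [NNReal.smul_def, Real.coe_toNNReal _ (pow_nonneg hx.out.le _), smul_eq_mul]
      · exact (measurable_subtype_coe.pow_const _).real_toNNReal

/-- Both sides integrate against Haar measures of the same space. The value of `c` is irrelevant: it
is eliminated when the sphere measure is normalized. -/
theorem exists_volume_euclidean_eq_smul (ι : Type*) [Fintype ι] :
    ∃ c : NNReal, ∀ f : (ι → ℂ) → ℝ,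
      ∫ z : EuclideanSpace ℂ ι, f (WithLp.ofLp z) = c * ∫ z : ι → ℂ, f z := by
  let e : EuclideanSpace ℂ ι ≃L[ℝ] (ι → ℂ) := PiLp.continuousLinearEquiv 2 ℝ fun _ : ι => ℂ
  have : (Measure.map e (volume : Measure (EuclideanSpace ℂ ι))).IsAddHaarMeasure :=
    e.isAddHaarMeasure_map _
  obtain ⟨c, h⟩ : ∃ c : NNReal, Measure.map e (volume : Measure (EuclideanSpace ℂ ι)) =
      c • (volume : Measure (ι → ℂ)) := ⟨_, Measure.isAddLeftInvariant_eq_smul _ _⟩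
  refine ⟨c, fun f => ?_⟩
  have h2 := (e.toHomeomorph.measurableEmbedding.integral_map (μ := volume) f).symm
  refine (h2.trans ?_)
  change ∫ y, f y ∂(Measure.map e volume) = _
  rw [h, integral_smul_nnreal_measure, NNReal.smul_def, smul_eq_mul]

theorem integral_norm_pow_mul_exp (r : ℕ) :
    ∫ z : ℂ, ‖z‖ ^ (2 * r) * rexp (-‖z‖ ^ 2) = π * r.factorial := by
  have h := Complex.integral_rpow_mul_exp_neg_rpow (p := 2) (q := 2 * r) (by norm_num)
    (by have : (0 : ℝ) ≤ r := r.cast_nonneg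
        linarith)
  have e : ((2 * (r : ℝ) + 2) / 2) = r + 1 := by ring
  rw [e, Real.Gamma_nat_eq_factorial] at h
  rw [show π * (r.factorial : ℝ) = (2 * π / 2) * r.factorial by ring, ← h]
  refine integral_congr_ae (.of_forall fun z => ?_)
  simp only
  rw [← Real.rpow_natCast, ← Real.rpow_natCast ‖z‖ 2]
  push_cast
  rfl

theorem integral_coord_pow_mul_exp (ι : Type*) [Fintype ι] :
    ∃ c : ℝ, ∀ (i : ι) (r : ℕ),
      ∫ z : EuclideanSpace ℂ ι, ‖z i‖ ^ (2 * r) * rexp (-‖z‖ ^ 2) = c * r.factorial := by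
  classical
  obtain ⟨c, hc⟩ := exists_volume_euclidean_eq_smul ι
  refine ⟨c * π ^ Fintype.card ι, fun i r => ?_⟩
  -- Coordinates other than `i` get exponent 0 and contribute π each; coordinate `i` contributes π
  -- r!.
  have h := hc fun z => ∏ j, ‖z j‖ ^ (2 * (if j = i then r else 0)) * rexp (-‖z j‖ ^ 2)
  rw [integral_fintype_prod_volume_eq_prod
    (fun j z => ‖z‖ ^ (2 * (if j = i then r else 0)) * rexp (-‖z‖ ^ 2))] at h
  simp_rw [integral_norm_pow_mul_exp] at h
  rw [Finset.prod_mul_distrib, Finset.prod_const, Finset.card_univ] at h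
  have h3 : ∏ j : ι, (((if j = i then r else 0).factorial : ℕ) : ℝ) = r.factorial := by
    rw [Finset.prod_eq_single i] <;> simp +contextual
  rw [h3, ← mul_assoc] at h
  rw [← h]
  refine integral_congr_ae (.of_forall fun z => ?_)
  simp only
  rw [Finset.prod_mul_distrib, ← Real.exp_sum, Finset.prod_eq_single i, if_pos rfl,
    Finset.sum_neg_distrib, EuclideanSpace.norm_sq_eq]
  · intro j _ hj
    simp [hj]
  · simp

/-- The Gaussian is unitarily invariant: extending `v` to an orthonormal basis turns ⟨v, z⟩ into a
coordinate. -/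
theorem integral_inner_pow_mul_exp (ι : Type*) [Fintype ι] :
    ∃ c : ℝ, ∀ (v : EuclideanSpace ℂ ι) (r : ℕ), ‖v‖ = 1 →
      ∫ z : EuclideanSpace ℂ ι, ‖inner ℂ v z‖ ^ (2 * r) * rexp (-‖z‖ ^ 2) =
        c * r.factorial := by
  classical
  obtain ⟨c, hc⟩ := integral_coord_pow_mul_exp ι
  refine ⟨c, fun v r hv => ?_⟩
  have hne : Nonempty ι := by
    by_contra h
    rw [not_nonempty_iff] at h
    rw [Subsingleton.elim v 0] at hv
    simp at hv
  obtain ⟨i⟩ := hne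
  have ho : Orthonormal ℂ (Set.domRestrict {i} (fun _ : ι => v)) := by
    refine ⟨fun _ => hv, fun a b hab => (hab (Subsingleton.elim _ _)).elim⟩
  obtain ⟨b, hb⟩ := ho.exists_orthonormalBasis_extension_of_card_eq (by simp)
  have hbi : b i = v := hb i rfl
  let U : EuclideanSpace ℂ ι ≃ₗᵢ[ℝ] EuclideanSpace ℂ ι :=
    { b.repr.toLinearEquiv.restrictScalars ℝ with norm_map' := b.repr.norm_map }
  have hU : ∀ z, U z = b.repr z := fun _ => rfl
  rw [← hc i r, ← U.measurePreserving.integral_comp U.toHomeomorph.measurableEmbedding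
    (fun z : EuclideanSpace ℂ ι => ‖z i‖ ^ (2 * r) * rexp (-‖z‖ ^ 2))]
  refine integral_congr_ae (.of_forall fun z => ?_)
  simp only
  rw [LinearIsometryEquiv.norm_map, hU, b.repr_apply_apply, hbi]

theorem finrank_real_euclidean (ι : Type*) [Fintype ι] :
    Module.finrank ℝ (EuclideanSpace ℂ ι) = 2 * Fintype.card ι := by
  rw [finrank_real_of_complex, finrank_euclideanSpace]

theorem integral_radial (D r : ℕ) (hD : 0 < D) :
    ∫ t in Set.Ioi (0 : ℝ), t ^ (2 * D - 1) * (t ^ (2 * r) * rexp (-t ^ 2)) =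
      (D + r - 1).factorial / 2 := by
  have h := integral_rpow_mul_exp_neg_rpow (p := 2) (q := (2 * D - 1 + 2 * r : ℕ)) (by norm_num)
    (lt_of_lt_of_le (by norm_num) (Nat.cast_nonneg _))
  have e : (((2 * D - 1 + 2 * r : ℕ) : ℝ) + 1) / 2 = ((D + r - 1 : ℕ) : ℝ) + 1 := by
    have h1 : (((2 * D - 1 + 2 * r : ℕ) : ℝ) + 1) = ((2 * D - 1 + 2 * r + 1 : ℕ) : ℝ) := by
      push_cast; ring
    have h2 : 2 * D - 1 + 2 * r + 1 = 2 * (D + r - 1 + 1) := by omega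
    rw [h1, h2]; push_cast; ring
  rw [e, Real.Gamma_nat_eq_factorial] at h
  rw [show ((D + r - 1).factorial : ℝ) / 2 = 1 / 2 * (D + r - 1).factorial by ring, ← h]
  refine setIntegral_congr_fun measurableSet_Ioi fun t _ => ?_
  rw [Real.rpow_natCast, Real.rpow_two, pow_add, mul_assoc]

instance [Nonempty ι] : IsProbabilityMeasure (uniform ι) := by
  constructor
  have h0 : (volume : Measure (EuclideanSpace ℂ ι)).toSphere Set.univ ≠ 0 := by
    rw [Ne, Measure.measure_univ_eq_zero]
    exact Measure.toSphere_ne_zero _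
  rw [uniform, Measure.smul_apply, smul_eq_mul]
  exact ENNReal.inv_mul_cancel h0 (measure_ne_top _ _)

/-- Polar coordinates factor the Gaussian moment into the sphere moment and a radial integral. The
case `r = 0` gives the total mass of the sphere; dividing by it normalizes the measure and cancels
`c`. -/
theorem integral_inner_pow_of_norm_eq_one [Nonempty ι] (v : EuclideanSpace ℂ ι) (hv : ‖v‖ = 1)
    (r : ℕ) :
    ∫ φ : UnitSphere ι, ‖inner ℂ v (φ : EuclideanSpace ℂ ι)‖ ^ (2 * r) ∂uniform ι =
      r.factorial * (Fintype.card ι - 1).factorial / (Fintype.card ι + r - 1).factorial := by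
  obtain ⟨c, hc⟩ := integral_inner_pow_mul_exp ι
  have key : ∀ r : ℕ, c * r.factorial =
      (∫ φ : UnitSphere ι, ‖inner ℂ v (φ : EuclideanSpace ℂ ι)‖ ^ (2 * r)
        ∂(volume : Measure (EuclideanSpace ℂ ι)).toSphere) *
      ((Fintype.card ι + r - 1).factorial / 2) := by
    intro r
    rw [← hc v r hv, ← integral_radial (Fintype.card ι) r Fintype.card_pos,
      integral_polar volume (fun φ => ‖inner ℂ v (φ : EuclideanSpace ℂ ι)‖ ^ (2 * r))
        (fun t => t ^ (2 * r) * rexp (-t ^ 2)), finrank_real_euclidean]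
    intro s t ht
    have e : (t • (s : EuclideanSpace ℂ ι)) = (t : ℂ) • (s : EuclideanSpace ℂ ι) := rfl
    rw [norm_smul, e, inner_smul_right, norm_mul, norm_eq_of_mem_sphere]
    simp only [Complex.norm_real, Real.norm_eq_abs, abs_of_pos ht]
    ring_nf
  have h0 := key 0
  have hr := key r
  set S := (volume : Measure (EuclideanSpace ℂ ι)).toSphere with hS
  have hS0 : S.real Set.univ ≠ 0 := by
    rw [Ne, measureReal_eq_zero_iff, Measure.measure_univ_eq_zero]
    exact Measure.toSphere_ne_zero _
  simp only [mul_zero, pow_zero, integral_const, smul_eq_mul, mul_one, add_zero,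
    Nat.factorial_zero, Nat.cast_one] at h0
  rw [uniform, integral_smul_measure, ENNReal.toReal_inv, ← Measure.real, smul_eq_mul,
    ← hS]
  rw [h0] at hr
  have hf : ((Fintype.card ι + r - 1).factorial : ℝ) ≠ 0 := by positivity
  field_simp at hr ⊢
  linear_combination (-1) * hr

theorem integral_inner_pow [Nonempty ι] (v : EuclideanSpace ℂ ι) {r : ℕ} (hr : r ≠ 0) :
    ∫ φ : UnitSphere ι, ‖inner ℂ v (φ : EuclideanSpace ℂ ι)‖ ^ (2 * r) ∂uniform ι =
      ‖v‖ ^ (2 * r) *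
      (r.factorial * (Fintype.card ι - 1).factorial / (Fintype.card ι + r - 1).factorial) := by
  by_cases h : v = 0
  · simp [h, hr]
  have hn : ‖v‖ ≠ 0 := norm_ne_zero_iff.2 h
  have h1 : ‖((‖v‖⁻¹ : ℝ) : ℂ) • v‖ = 1 := by
    rw [norm_smul]; simp [hn]
  rw [← integral_inner_pow_of_norm_eq_one _ h1, ← integral_const_mul]
  refine integral_congr_ae (.of_forall fun φ => ?_)
  simp only
  rw [inner_smul_left, norm_mul, mul_pow, ← mul_assoc]
  simp [hn]

theorem integral_inner_sq [Nonempty ι] (v : EuclideanSpace ℂ ι) :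
    ∫ φ : UnitSphere ι, ‖inner ℂ v (φ : EuclideanSpace ℂ ι)‖ ^ 2 ∂uniform ι =
      ‖v‖ ^ 2 / Fintype.card ι := by
  have h := integral_inner_pow v one_ne_zero
  simp only [mul_one, Nat.factorial_one, Nat.cast_one, one_mul] at h
  have hD : 0 < Fintype.card ι := Fintype.card_pos
  obtain ⟨m, hm⟩ := Nat.exists_eq_succ_of_ne_zero hD.ne'
  rw [h, hm]
  simp only [Nat.succ_eq_add_one, Nat.add_sub_cancel, Nat.factorial_succ]
  have : (m.factorial : ℝ) ≠ 0 := by positivity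
  push_cast
  field_simp

theorem integral_inner_pow_le [Nonempty ι] (v : EuclideanSpace ℂ ι) {r : ℕ} (hr : r ≠ 0) :
    ∫ φ : UnitSphere ι, ‖inner ℂ v (φ : EuclideanSpace ℂ ι)‖ ^ (2 * r) ∂uniform ι ≤
      ‖v‖ ^ (2 * r) * (r.factorial / (Fintype.card ι : ℝ) ^ r) := by
  rw [integral_inner_pow v hr]
  have hD : 0 < Fintype.card ι := Fintype.card_pos
  obtain ⟨m, hm⟩ := Nat.exists_eq_succ_of_ne_zero hD.ne'
  rw [hm]
  -- With m = D - 1 this reads (D - 1)! D^r ≤ (D + r - 1)!.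
  have h := Nat.factorial_mul_pow_le_factorial (m := m) (n := r)
  have h1 : m.succ + r - 1 = m + r := by omega
  rw [h1, Nat.succ_sub_one]
  refine mul_le_mul_of_nonneg_left ?_ (by positivity)
  rw [div_le_div_iff₀ (by positivity) (by positivity), mul_assoc]
  refine mul_le_mul_of_nonneg_left ?_ (by positivity)
  exact_mod_cast h

theorem integrable_of_continuous [Nonempty ι] {f : UnitSphere ι → ℝ} (hf : Continuous f) :
    Integrable f (uniform ι) :=
  hf.integrable_of_hasCompactSupport (HasCompactSupport.of_compactSpace f)

/-- After normalizing the vectors, the product is at most the r-th power of its largest factor,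
hence at most the sum of all r-th powers. The extra factor `r` is harmless because it does not
depend on the dimension. -/
theorem integral_prod_inner_sq_le [Nonempty ι] {r : ℕ} (hr : r ≠ 0)
    (v : Fin r → EuclideanSpace ℂ ι) :
    ∫ φ : UnitSphere ι, ∏ i, ‖inner ℂ (v i) (φ : EuclideanSpace ℂ ι)‖ ^ 2 ∂uniform ι ≤
      (∏ i, ‖v i‖ ^ 2) * (r * (r.factorial / (Fintype.card ι : ℝ) ^ r)) := by
  by_cases h : ∃ i, v i = 0
  · obtain ⟨i, hi⟩ := h
    have h1 : ∀ φ : UnitSphere ι, ∏ i, ‖inner ℂ (v i) (φ : EuclideanSpace ℂ ι)‖ ^ 2 = 0 :=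
      fun φ => Finset.prod_eq_zero (Finset.mem_univ i) (by simp [hi])
    simp_rw [h1]
    simp only [integral_zero]
    positivity
  push Not at h
  have hn : ∀ i, ‖v i‖ ≠ 0 := fun i => norm_ne_zero_iff.2 (h i)
  set w : Fin r → EuclideanSpace ℂ ι := fun i => ((‖v i‖⁻¹ : ℝ) : ℂ) • v i with hw
  have hw1 : ∀ i, ‖w i‖ = 1 := fun i => by
    rw [hw, norm_smul]; simp [hn]
  have hvw : ∀ i, v i = ((‖v i‖ : ℝ) : ℂ) • w i := fun i => by
    rw [hw, smul_smul]; simp [hn]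
  have hcont : ∀ u : EuclideanSpace ℂ ι, Continuous fun φ : UnitSphere ι =>
      ‖inner ℂ u (φ : EuclideanSpace ℂ ι)‖ := fun u => by fun_prop
  have key : ∀ φ : UnitSphere ι, ∏ i, ‖inner ℂ (v i) (φ : EuclideanSpace ℂ ι)‖ ^ 2 ≤
      (∏ i, ‖v i‖ ^ 2) * ∑ i, ‖inner ℂ (w i) (φ : EuclideanSpace ℂ ι)‖ ^ (2 * r) := by
    intro φ
    have e : ∀ i, ‖inner ℂ (v i) (φ : EuclideanSpace ℂ ι)‖ ^ 2 =
        ‖v i‖ ^ 2 * ‖inner ℂ (w i) (φ : EuclideanSpace ℂ ι)‖ ^ 2 := fun i => by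
      conv_lhs => rw [hvw i]
      rw [inner_smul_left, norm_mul, mul_pow]
      simp
    simp_rw [e]
    rw [Finset.prod_mul_distrib]
    refine mul_le_mul_of_nonneg_left ?_ (by positivity)
    have : Nonempty (Fin r) := ⟨⟨0, Nat.pos_of_ne_zero hr⟩⟩
    obtain ⟨j, hj⟩ := Finite.exists_max fun i =>
      ‖inner ℂ (w i) (φ : EuclideanSpace ℂ ι)‖ ^ 2
    calc _ ≤ ∏ i : Fin r, ‖inner ℂ (w j) (φ : EuclideanSpace ℂ ι)‖ ^ 2 :=
          Finset.prod_le_prod (fun i _ => by positivity) fun i _ => hj i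
      _ = ‖inner ℂ (w j) (φ : EuclideanSpace ℂ ι)‖ ^ (2 * r) := by
          rw [Finset.prod_const, Finset.card_univ, Fintype.card_fin, pow_mul]
      _ ≤ _ := Finset.single_le_sum
          (f := fun i => ‖inner ℂ (w i) (φ : EuclideanSpace ℂ ι)‖ ^ (2 * r))
          (fun i _ => by positivity) (Finset.mem_univ j)
  calc _ ≤ ∫ φ : UnitSphere ι, (∏ i, ‖v i‖ ^ 2) *
        ∑ i, ‖inner ℂ (w i) (φ : EuclideanSpace ℂ ι)‖ ^ (2 * r) ∂uniform ι :=
        integral_mono (integrable_of_continuous (by fun_prop))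
          (integrable_of_continuous (by fun_prop)) key
    _ ≤ _ := by
        rw [integral_const_mul, integral_finsetSum _ fun i _ =>
          integrable_of_continuous (by fun_prop)]
        refine mul_le_mul_of_nonneg_left ?_ (by positivity)
        refine (Finset.sum_le_sum fun i _ => integral_inner_pow_le (w i) hr).trans ?_
        simp [hw1]

end Sphere

open scoped MatrixOrder Matrix.Norms.L2Operator in
theorem PosSemidef.exists_eq_conjTranspose_mul_self {ι : Type*} [Fintype ι] [DecidableEq ι]
    {M : Mat ι} (hM : M.PosSemidef) : ∃ B : Mat ι, M = B.conjTranspose * B :=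
  CStarAlgebra.nonneg_iff_eq_star_mul_self.mp hM.nonneg

/-! ### Tensor products of matrices -/

section PiTensor
variable {ι : Type*} {n : ℕ}

/-- The tensor product `⊗ᵢ Mᵢ` of a finite family of matrices. -/
def piTensor (M : Fin n → Mat ι) : Mat (Fin n → ι) :=
  Matrix.of fun a b => ∏ i, M i (a i) (b i)

theorem piTensor_apply (M : Fin n → Mat ι) (a b : Fin n → ι) :
    piTensor M a b = ∏ i, M i (a i) (b i) := rfl

theorem piTensor_conjTranspose (M : Fin n → Mat ι) :
    (piTensor M).conjTranspose = piTensor fun i => (M i).conjTranspose := by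
  ext a b
  simp [piTensor_apply, Matrix.conjTranspose_apply]

theorem piTensor_smul (c : ℂ) (M : Fin n → Mat ι) :
    piTensor (fun i => c • M i) = c ^ n • piTensor M := by
  ext a b
  simp [piTensor_apply, Finset.prod_mul_distrib]

theorem piTensor_one [DecidableEq ι] : piTensor (fun _ : Fin n => (1 : Mat ι)) = 1 := by
  ext a b
  rw [piTensor_apply, Matrix.one_apply]
  split_ifs with h
  · subst h
    exact Finset.prod_eq_one fun i _ => Matrix.one_apply_eq _
  · obtain ⟨i, hi⟩ := Function.ne_iff.1 h
    exact Finset.prod_eq_zero (Finset.mem_univ i) (Matrix.one_apply_ne hi)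

theorem sum_piTensor {K : Type*} [Fintype K] (X : Fin n → K → Mat ι) :
    ∑ k : Fin n → K, piTensor (fun i => X i (k i)) = piTensor fun i => ∑ k, X i k := by
  classical
  ext a b
  simp only [Matrix.sum_apply, piTensor_apply]
  rw [Finset.prod_univ_sum, Fintype.piFinset_univ]

variable [Fintype ι]

theorem piTensor_mul (M N : Fin n → Mat ι) :
    piTensor M * piTensor N = piTensor fun i => M i * N i := by
  classical
  ext a b
  simp only [Matrix.mul_apply, piTensor_apply, ← Finset.prod_mul_distrib]
  rw [Finset.prod_univ_sum, Fintype.piFinset_univ]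

theorem trace_piTensor (M : Fin n → Mat ι) : (piTensor M).trace = ∏ i, (M i).trace := by
  classical
  simp only [Matrix.trace, Matrix.diag, piTensor_apply]
  rw [Finset.prod_univ_sum, Fintype.piFinset_univ]

theorem prod_ofFn_piTensor [DecidableEq ι] {m : ℕ} (M : Fin m → Fin n → Mat ι) :
    (List.ofFn fun j => piTensor (M j)).prod =
      piTensor fun i => (List.ofFn fun j => M j i).prod := by
  induction m with
  | zero => simp [piTensor_one]
  | succ m ih => simp only [List.ofFn_succ, List.prod_cons, ih, piTensor_mul]

theorem piTensor_pow [DecidableEq ι] (M : Fin n → Mat ι) (m : ℕ) :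
    piTensor M ^ m = piTensor fun i => M i ^ m := by
  have h := prod_ofFn_piTensor (m := m) fun _ => M
  simpa [List.ofFn_const, List.prod_replicate] using h

theorem posSemidef_piTensor [DecidableEq ι] {M : Fin n → Mat ι} (hM : ∀ i, (M i).PosSemidef) :
    (piTensor M).PosSemidef := by
  have h : ∀ i, ∃ B : Mat ι, M i = B.conjTranspose * B := fun i =>
    PosSemidef.exists_eq_conjTranspose_mul_self (hM i)
  choose B hB using h
  have e : piTensor M = (piTensor B).conjTranspose * piTensor B := by
    rw [piTensor_conjTranspose, piTensor_mul]
    exact congrArg piTensor (funext hB)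
  rw [e]
  exact Matrix.posSemidef_conjTranspose_mul_self _

end PiTensor

/-! ### Entanglement-breaking channels, their tensor powers and the permutation sums Q -/

section EntanglementBreaking
variable {ι K : Type*} [Fintype ι] [DecidableEq ι] [Fintype K]
  {A : Mat ι →ₗ[ℂ] Mat ι} {σ X : K → Mat ι}

theorem trace_mul_single (M : Mat ι) (x y : ι) : (M * Matrix.single x y 1).trace = M y x := by
  simp [Matrix.trace_mul_single]

theorem IsEntanglementBreaking.apply_single (hA : IsEntanglementBreaking A σ X) (x y : ι) :
    A (Matrix.single x y 1) = ∑ k, X k y x • σ k := by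
  rw [hA.apply_eq]
  simp_rw [trace_mul_single]

/-- Stability under tensor powers lets every later estimate be proved for one channel of arbitrary
dimension and then applied to each power. -/
theorem IsEntanglementBreaking.tensorPower (hA : IsEntanglementBreaking A σ X) (n : ℕ) :
    IsEntanglementBreaking (tensorPower A n) (fun k : Fin n → K => piTensor fun i => σ (k i))
      (fun k : Fin n → K => piTensor fun i => X (k i)) where
  density k := ⟨posSemidef_piTensor fun i => (hA.density _).1, by
    rw [trace_piTensor]
    exact Finset.prod_eq_one fun i _ => (hA.density _).2⟩
  povm := ⟨fun k => posSemidef_piTensor fun i => hA.povm.1 _, by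
    rw [sum_piTensor fun _ => X, hA.povm.2, piTensor_one]⟩
  apply_eq ρ := by
    classical
    ext a b
    simp only [AvgOutputEntropy.tensorPower, LinearMap.coe_mk, AddHom.coe_mk, Matrix.of_apply,
      hA.apply_single, Matrix.sum_apply, Matrix.smul_apply, smul_eq_mul, Matrix.trace,
      Matrix.diag, Matrix.mul_apply, piTensor_apply]
    simp_rw [Finset.prod_univ_sum, Fintype.piFinset_univ, Finset.sum_mul, Finset.mul_sum,
      Finset.prod_mul_distrib]
    rw [Finset.sum_comm]
    rw [Finset.sum_comm_cycle]
    refine Finset.sum_congr rfl fun k _ => Finset.sum_congr rfl fun x _ =>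
      Finset.sum_congr rfl fun y _ => by ring

omit [Fintype K] in
theorem TraceProdNonneg.piTensor {m : ℕ} (h : TraceProdNonneg m σ) (n : ℕ) :
    TraceProdNonneg m fun k : Fin n → K => piTensor fun i => σ (k i) := by
  intro k
  rw [prod_ofFn_piTensor fun j i => σ (k j i), trace_piTensor]
  exact Finset.prod_nonneg fun i _ => h fun j => k j i

theorem tensorPower_one (A : Mat ι →ₗ[ℂ] Mat ι) (n : ℕ) :
    tensorPower A n 1 = piTensor fun _ => A 1 := by
  classical
  ext a b
  have h : (1 : Mat ι) = ∑ x, Matrix.single x x 1 := (Matrix.sum_single_one).symm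
  simp only [AvgOutputEntropy.tensorPower, LinearMap.coe_mk, AddHom.coe_mk, Matrix.of_apply,
    piTensor_apply, Matrix.one_apply, ite_mul, one_mul, zero_mul, Finset.sum_ite_eq,
    Finset.mem_univ, if_true]
  conv_rhs => rw [h, map_sum]
  simp_rw [Matrix.sum_apply]
  rw [Finset.prod_univ_sum, Fintype.piFinset_univ]

theorem prod_ofFn_sum_smul {R : Type*} [Ring R] [Algebra ℂ R] {r : ℕ} (c : Fin r → K → ℂ)
    (s : Fin r → K → R) :
    (List.ofFn fun i => ∑ k, c i k • s i k).prod =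
      ∑ k : Fin r → K, (∏ i, c i (k i)) • (List.ofFn fun i => s i (k i)).prod := by
  induction r with
  | zero => simp
  | succ r ih =>
    rw [List.ofFn_succ, List.prod_cons, ih, ← (Fin.consEquiv fun _ => K).sum_comp,
      Fintype.sum_prod_type, Finset.sum_mul]
    refine Finset.sum_congr rfl fun k _ => ?_
    rw [Finset.mul_sum]
    refine Finset.sum_congr rfl fun l _ => ?_
    simp [Fin.consEquiv, List.ofFn_succ, Fin.prod_univ_succ, smul_smul, mul_comm]

theorem IsEntanglementBreaking.trace_prod_apply (hA : IsEntanglementBreaking A σ X) {r : ℕ}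
    (ρ : Fin r → Mat ι) :
    ((List.ofFn fun i => A (ρ i)).prod).trace = ∑ k : Fin r → K,
      (∏ i, (X (k i) * ρ i).trace) * ((List.ofFn fun i => σ (k i)).prod).trace := by
  simp_rw [hA.apply_eq]
  rw [prod_ofFn_sum_smul (fun i k => (X k * ρ i).trace) fun _ => σ, Matrix.trace_sum]
  simp_rw [Matrix.trace_smul, smul_eq_mul]

theorem IsEntanglementBreaking.trace_apply_pow (hA : IsEntanglementBreaking A σ X) (r : ℕ)
    (ρ : Mat ι) :
    (A ρ ^ r).trace = ∑ k : Fin r → K,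
      (∏ i, (X (k i) * ρ).trace) * ((List.ofFn fun i => σ (k i)).prod).trace := by
  rw [← hA.trace_prod_apply fun _ => ρ, List.ofFn_const, List.prod_replicate]

theorem exists_rank_one_sum {M : Mat ι} (hM : M.PosSemidef) :
    ∃ v : ι → EuclideanSpace ℂ ι, ∀ a b, M a b = ∑ j, v j a * star (v j b) := by
  obtain ⟨B, rfl⟩ := PosSemidef.exists_eq_conjTranspose_mul_self hM
  exact ⟨fun j => WithLp.toLp 2 fun a => star (B j a), fun a b => by
    simp [Matrix.mul_apply, Matrix.conjTranspose_apply]⟩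

omit [DecidableEq ι] in
theorem trace_of_rank_one_sum {M : Mat ι} {v : ι → EuclideanSpace ℂ ι}
    (hv : ∀ a b, M a b = ∑ j, v j a * star (v j b)) :
    M.trace = ((∑ j, ‖v j‖ ^ 2 : ℝ) : ℂ) := by
  simp only [Matrix.trace, Matrix.diag, hv, EuclideanSpace.norm_sq_eq]
  rw [Finset.sum_comm]
  push_cast
  refine Finset.sum_congr rfl fun j _ => Finset.sum_congr rfl fun a _ => ?_
  exact Complex.mul_conj' _

omit [DecidableEq ι] in
theorem trace_mul_pureState_of_rank_one_sum {M : Mat ι} {v : ι → EuclideanSpace ℂ ι}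
    (hv : ∀ a b, M a b = ∑ j, v j a * star (v j b)) (φ : UnitSphere ι) :
    (M * pureState φ).trace =
      ((∑ j, ‖inner ℂ (v j) (φ : EuclideanSpace ℂ ι)‖ ^ 2 : ℝ) : ℂ) := by
  have e : ∀ j, ((‖inner ℂ (v j) (φ : EuclideanSpace ℂ ι)‖ ^ 2 : ℝ) : ℂ) =
      ∑ a, ∑ b, (v j a * star (v j b)) *
        ((φ : EuclideanSpace ℂ ι) b * star ((φ : EuclideanSpace ℂ ι) a)) := by
    intro j
    push_cast
    rw [← Complex.mul_conj']
    simp only [PiLp.inner_apply, RCLike.inner_apply, map_sum, map_mul, Complex.conj_conj]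
    rw [mul_comm, Finset.sum_mul_sum]
    refine Finset.sum_congr rfl fun a _ => Finset.sum_congr rfl fun b _ => ?_
    simp only [Complex.star_def]
    ring
  push_cast at e ⊢
  simp_rw [e]
  rw [Finset.sum_comm]
  simp only [Matrix.trace, Matrix.diag, Matrix.mul_apply, pureState, Matrix.of_apply, hv,
    Finset.sum_mul]
  refine Finset.sum_congr rfl fun a _ => ?_
  rw [Finset.sum_comm]

/-- For rank-one Y's the sum over x is a product of inner products in which every vector occurs
exactly twice, so Cauchy-Schwarz gives ∏ ‖v‖². The general case follows by multilinearity. -/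
theorem norm_sum_prod_perm_le {r : ℕ} (α : Equiv.Perm (Fin r)) {Y : Fin r → Mat ι}
    (hY : ∀ i, (Y i).PosSemidef) :
    ‖∑ x : Fin r → ι, ∏ i, Y i (x (α i)) (x i)‖ ≤ ∏ i, (Y i).trace.re := by
  classical
  choose v hv using fun i => exists_rank_one_sum (hY i)
  -- Collecting the factors at coordinate l pairs the conjugated vector of `Y l` with the vector of
  -- `Y (α.symm l)`.
  have e : ∑ x : Fin r → ι, ∏ i, Y i (x (α i)) (x i) =
      ∑ j : Fin r → ι, ∏ l, inner ℂ (v l (j l)) (v (α.symm l) (j (α.symm l))) := by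
    simp_rw [hv, Finset.prod_univ_sum, Fintype.piFinset_univ]
    rw [Finset.sum_comm]
    refine Finset.sum_congr rfl fun j _ => ?_
    simp only [PiLp.inner_apply, RCLike.inner_apply]
    rw [Finset.prod_univ_sum, Fintype.piFinset_univ]
    refine Finset.sum_congr rfl fun x _ => ?_
    rw [Finset.prod_mul_distrib, Finset.prod_mul_distrib,
      ← Equiv.prod_comp α fun l => (v (α.symm l) (j (α.symm l))) (x l)]
    simp
  rw [e]
  have t : ∀ i, (Y i).trace.re = ∑ j, ‖v i j‖ ^ 2 := fun i => by
    rw [trace_of_rank_one_sum (hv i), Complex.ofReal_re]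
  simp_rw [t]
  rw [Finset.prod_univ_sum, Fintype.piFinset_univ]
  refine (norm_sum_le _ _).trans (Finset.sum_le_sum fun j _ => ?_)
  rw [norm_prod]
  calc _ ≤ ∏ l, ‖v l (j l)‖ * ‖v (α.symm l) (j (α.symm l))‖ :=
        Finset.prod_le_prod (fun _ _ => norm_nonneg _) fun l _ => norm_inner_le_norm _ _
    _ = _ := by
        rw [Finset.prod_mul_distrib, Equiv.prod_comp α.symm fun l => ‖v l (j l)‖,
          ← Finset.prod_mul_distrib]
        simp_rw [sq]

theorem Q_one (A : Mat ι →ₗ[ℂ] Mat ι) (r : ℕ) : Q A r 1 = (A 1 ^ r).trace := by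
  have h : (1 : Mat ι) = ∑ x, (1 : ℂ) • Matrix.single x x 1 := by
    simp_rw [one_smul]
    exact (Matrix.sum_single_one).symm
  have h2 : A 1 = ∑ x, (1 : ℂ) • A (Matrix.single x x 1) := by
    conv_lhs => rw [h]
    simp
  rw [← List.prod_replicate, ← List.ofFn_const, h2,
    prod_ofFn_sum_smul (fun _ _ => 1) (fun _ x => A (Matrix.single x x 1)), Matrix.trace_sum, Q]
  simp

omit [DecidableEq ι] in
theorem PosSemidef.ofReal_re_trace {M : Mat ι} (hM : M.PosSemidef) :
    ((M.trace.re : ℝ) : ℂ) = M.trace :=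
  Complex.ext rfl (Complex.nonneg_iff.1 hM.trace_nonneg).2

/-- Both sums expand over `k` with the same nonnegative weights Tr ∏ σ, so only the POVM factors
have to be compared. The order of `ℂ` makes the inequality also assert that `Q A r 1` is real. -/
theorem norm_Q_le (hA : IsEntanglementBreaking A σ X) {r : ℕ} (h : TraceProdNonneg r σ)
    (α : Equiv.Perm (Fin r)) : ((‖Q A r α‖ : ℝ) : ℂ) ≤ Q A r 1 := by
  have e : Q A r α = ∑ k : Fin r → K, (∑ x : Fin r → ι, ∏ i, X (k i) (x (α i)) (x i)) *
      ((List.ofFn fun i => σ (k i)).prod).trace := by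
    simp_rw [Q, hA.trace_prod_apply, trace_mul_single]
    rw [Finset.sum_comm]
    simp_rw [Finset.sum_mul]
  have e1 : Q A r 1 = ((∑ k : Fin r → K, (∏ i, (X (k i)).trace.re) *
      ‖((List.ofFn fun i => σ (k i)).prod).trace‖ : ℝ) : ℂ) := by
    rw [Q_one, hA.trace_apply_pow]
    push_cast
    refine Finset.sum_congr rfl fun k _ => ?_
    congr 1
    · exact Finset.prod_congr rfl fun i _ => by
        rw [mul_one, PosSemidef.ofReal_re_trace (hA.povm.1 _)]
    · rw [Complex.norm_of_nonneg' (h k)]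
  rw [e1, Complex.real_le_real, e]
  refine (norm_sum_le _ _).trans (Finset.sum_le_sum fun k _ => ?_)
  rw [norm_mul]
  exact mul_le_mul_of_nonneg_right (norm_sum_prod_perm_le α fun i => hA.povm.1 _)
    (norm_nonneg _)

end EntanglementBreaking

/-! ### Trace inequalities for density matrices -/

section Spectral
variable {ι : Type*} [Fintype ι] [DecidableEq ι] {ρ B : Mat ι}

/-- The weights are the squared overlaps |⟨uᵢ, vⱼ⟩|² of the two eigenbases. They do not depend on
`f` and `g`, so scalar inequalities in two variables pass to traces. -/
theorem trace_cfc_mul_cfc (hρ : ρ.IsHermitian) (hB : B.IsHermitian) :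
    ∃ w : ι → ι → ℝ, (∀ i j, 0 ≤ w i j) ∧ ∀ f g : ℝ → ℝ, (cfc f ρ * cfc g B).trace.re =
      ∑ i, ∑ j, w i j * (f (hρ.eigenvalues i) * g (hB.eigenvalues j)) := by
  set U : Mat ι := (hρ.eigenvectorUnitary : Mat ι) with hU
  set V : Mat ι := (hB.eigenvectorUnitary : Mat ι) with hV
  refine ⟨fun i j => ‖(star U * V) i j‖ ^ 2, fun i j => by positivity, fun f g => ?_⟩
  rw [hρ.cfc_eq, hB.cfc_eq, Matrix.IsHermitian.cfc, Matrix.IsHermitian.cfc,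
    Unitary.conjStarAlgAut_apply, Unitary.conjStarAlgAut_apply, ← hU, ← hV]
  set F := Matrix.diagonal ((RCLike.ofReal : ℝ → ℂ) ∘ f ∘ hρ.eigenvalues)
  set G := Matrix.diagonal ((RCLike.ofReal : ℝ → ℂ) ∘ g ∘ hB.eigenvalues)
  have e : (U * F * star U * (V * G * star V)).trace =
      (F * ((star U * V) * (G * star (star U * V)))).trace := by
    rw [star_mul, star_star, mul_assoc U F, mul_assoc U, Matrix.trace_mul_comm]
    simp only [mul_assoc]
  rw [e, Matrix.trace, Complex.re_sum]
  refine Finset.sum_congr rfl fun i _ => ?_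
  rw [Matrix.diag_apply, Matrix.diagonal_mul, Matrix.mul_apply, Finset.mul_sum, Complex.re_sum]
  refine Finset.sum_congr rfl fun j _ => ?_
  rw [Matrix.diagonal_mul, Matrix.star_apply]
  set z := (star U * V) i j
  have : ((RCLike.ofReal : ℝ → ℂ) ∘ f ∘ hρ.eigenvalues) i *
      (z * (((RCLike.ofReal : ℝ → ℂ) ∘ g ∘ hB.eigenvalues) j * star z)) =
      ((‖z‖ ^ 2 * (f (hρ.eigenvalues i) * g (hB.eigenvalues j)) : ℝ) : ℂ) := by
    push_cast
    rw [← Complex.mul_conj']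
    simp only [Function.comp_apply, Complex.coe_algebraMap, Complex.star_def]
    ring
  rw [this, Complex.ofReal_re]

theorem trFun_eq_sum (hρ : ρ.IsHermitian) (f : ℝ → ℝ) :
    trFun f ρ = ∑ i, f (hρ.eigenvalues i) := by
  rw [trFun, hρ.cfc_eq, Matrix.IsHermitian.cfc, Unitary.conjStarAlgAut_apply,
    Matrix.trace_mul_comm, ← mul_assoc, Unitary.coe_star_mul_self, one_mul, Matrix.trace_diagonal,
    Complex.re_sum]
  rfl

theorem cfc_pow_natCast (hρ : ρ.IsHermitian) (r : ℕ) : cfc (fun x : ℝ => x ^ r) ρ = ρ ^ r :=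
  cfc_pow_id ρ r hρ

theorem trPow_natCast (hρ : ρ.IsHermitian) (r : ℕ) : trPow (r : ℝ) ρ = (ρ ^ r).trace.re := by
  rw [trPow, trFun]
  simp_rw [Real.rpow_natCast]
  rw [cfc_pow_natCast hρ]

/-- This says that the graph of x ↦ x^(n+1) lies above its tangent at `b`. -/
theorem succ_mul_le_pow_add {a b : ℝ} (ha : 0 ≤ a) (hb : 0 ≤ b) (n : ℕ) :
    (n + 1) * (a * b ^ n) ≤ a ^ (n + 1) + n * b ^ (n + 1) := by
  induction n with
  | zero => simp
  | succ n ih =>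
    have h1 := mul_le_mul_of_nonneg_right ih hb
    have h2 : 0 ≤ (a - b) * (a ^ (n + 1) - b ^ (n + 1)) := by
      rcases le_total a b with h | h
      · exact mul_nonneg_of_nonpos_of_nonpos (sub_nonpos.2 h)
          (sub_nonpos.2 (pow_le_pow_left₀ ha h _))
      · exact mul_nonneg (sub_nonneg.2 h) (sub_nonneg.2 (pow_le_pow_left₀ hb h _))
    push_cast
    ring_nf at h1 h2 ⊢
    linarith

/-- Klein's inequality for the function `x ↦ x ^ (n + 1)`. -/
theorem klein_pow (hρ : ρ.PosSemidef) (hB : B.PosSemidef) (n : ℕ) :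
    (n + 1) * (ρ * B ^ n).trace.re ≤
      (ρ ^ (n + 1)).trace.re + n * (B ^ (n + 1)).trace.re := by
  obtain ⟨w, hw, h⟩ := trace_cfc_mul_cfc hρ.1 hB.1
  have h1 := h (fun x => x ^ 1) (fun x => x ^ n)
  have h2 := h (fun x => x ^ (n + 1)) (fun x => x ^ 0)
  have h3 := h (fun x => x ^ 0) (fun x => x ^ (n + 1))
  rw [cfc_pow_natCast hρ.1, cfc_pow_natCast hB.1] at h1 h2 h3
  simp only [pow_one, pow_zero, mul_one, one_mul] at h1 h2 h3
  rw [h1, h2, h3]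
  simp only [Finset.mul_sum, ← Finset.sum_add_distrib]
  refine Finset.sum_le_sum fun i _ => Finset.sum_le_sum fun j _ => ?_
  have := mul_le_mul_of_nonneg_left
    (succ_mul_le_pow_add (hρ.eigenvalues_nonneg i) (hB.eigenvalues_nonneg j) n) (hw i j)
  linarith

theorem IsDensity.sum_eigenvalues (hρ : IsDensity ρ) : ∑ i, hρ.1.1.eigenvalues i = 1 := by
  have h := hρ.1.1.trace_eq_sum_eigenvalues
  have := congrArg Complex.re (hρ.2.symm.trans h)
  simpa using this.symm

theorem IsDensity.eigenvalues_mem (hρ : IsDensity ρ) (i : ι) :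
    hρ.1.1.eigenvalues i ∈ Set.Icc (0 : ℝ) 1 :=
  ⟨hρ.1.eigenvalues_nonneg i, by
    rw [← hρ.sum_eigenvalues]
    exact Finset.single_le_sum (fun j _ => hρ.1.eigenvalues_nonneg j) (Finset.mem_univ i)⟩

theorem IsDensity.spectrum_subset (hρ : IsDensity ρ) : spectrum ℝ ρ ⊆ Set.Icc (0 : ℝ) 1 := by
  rw [hρ.1.1.spectrum_real_eq_range_eigenvalues]
  rintro _ ⟨i, rfl⟩
  exact hρ.eigenvalues_mem i

omit [DecidableEq ι] in
theorem IsDensity.nonempty (hρ : IsDensity ρ) : Nonempty ι := by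
  by_contra h
  rw [not_nonempty_iff] at h
  have := hρ.2
  simp [Matrix.trace] at this

open scoped Matrix.Norms.L2Operator in
theorem continuous_trFun {Y : Type*} [TopologicalSpace Y] {f : ℝ → ℝ}
    (hf : ContinuousOn f (Set.Icc 0 1)) {M : Y → Mat ι} (hM : Continuous M)
    (hd : ∀ y, IsDensity (M y)) : Continuous fun y => trFun f (M y) := by
  have h := (continuousOn_cfc (Mat ι) (p := IsSelfAdjoint) (isCompact_Icc (a := (0 : ℝ)) (b := 1)) f
    hf).comp_continuous hM fun y => ⟨(hd y).1.1, (hd y).spectrum_subset⟩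
  exact Complex.continuous_re.comp h.matrix_trace

/-- The bound `Tr ρ^r ≥ D^(1-r)`, attained at the maximally mixed state. -/
theorem IsDensity.card_rpow_le_trPow (hρ : IsDensity ρ) {r : ℝ} (hr : 1 ≤ r) :
    (Fintype.card ι : ℝ) ^ (1 - r) ≤ trPow r ρ := by
  have := hρ.nonempty
  have hD : (0 : ℝ) < Fintype.card ι := by exact_mod_cast Fintype.card_pos
  rw [trPow, trFun_eq_sum hρ.1.1]
  have h := Real.rpow_sum_le_const_mul_sum_rpow_of_nonneg Finset.univ hr
    (f := hρ.1.1.eigenvalues) (fun i _ => hρ.1.eigenvalues_nonneg i)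
  rw [hρ.sum_eigenvalues, Real.one_rpow, Finset.card_univ] at h
  rw [← neg_sub, Real.rpow_neg hD.le, inv_le_iff_one_le_mul₀ (by positivity)]
  linarith

theorem IsDensity.trPow_pos (hρ : IsDensity ρ) {r : ℝ} (hr : 1 ≤ r) : 0 < trPow r ρ := by
  have := hρ.nonempty
  exact lt_of_lt_of_le (Real.rpow_pos_of_pos (by exact_mod_cast Fintype.card_pos) _)
    (hρ.card_rpow_le_trPow hr)

theorem rpow_tangent_le {t c q : ℝ} (ht : 0 ≤ t) (hc : 0 < c) (hq : 1 ≤ q) :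
    c ^ q * (1 - q) + q * c ^ q / c * t ≤ t ^ q := by
  have h := one_add_mul_self_le_rpow_one_add (s := t / c - 1)
    (by have := div_nonneg ht hc.le; linarith) hq
  have e : (1 + (t / c - 1)) = t / c := by ring
  rw [e, Real.div_rpow ht hc.le, le_div_iff₀ (by positivity)] at h
  calc _ = (1 + q * (t / c - 1)) * c ^ q := by ring
    _ ≤ _ := h

/-- With q = (m-1)/(r-1), p^m = p·(p^(r-1))^q. The tangent at `c` to the convex function t^q is
averaged with the eigenvalues p as weights. The result is affine in `trPow r ρ`, ready to be
integrated over φ. -/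
theorem IsDensity.trPow_tangent_le (hρ : IsDensity ρ) {r m c : ℝ} (hr : 1 < r) (hm : r ≤ m)
    (hc : 0 < c) :
    c ^ ((m - 1) / (r - 1)) * (1 - (m - 1) / (r - 1)) +
      (m - 1) / (r - 1) * c ^ ((m - 1) / (r - 1)) / c * trPow r ρ ≤ trPow m ρ := by
  set q := (m - 1) / (r - 1) with hq
  have hq1 : 1 ≤ q := by rw [hq, one_le_div (by linarith)]; linarith
  rw [trPow, trPow, trFun_eq_sum hρ.1.1, trFun_eq_sum hρ.1.1]
  calc _ = ∑ i, (hρ.1.1.eigenvalues i * (c ^ q * (1 - q)) +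
        q * c ^ q / c * hρ.1.1.eigenvalues i ^ r) := by
        rw [Finset.sum_add_distrib, ← Finset.sum_mul, hρ.sum_eigenvalues, one_mul, Finset.mul_sum]
    _ ≤ _ := Finset.sum_le_sum fun i _ => ?_
  have hp := hρ.1.eigenvalues_nonneg i
  set p := hρ.1.1.eigenvalues i
  rcases hp.eq_or_lt with h | h
  · rw [← h, Real.zero_rpow (by linarith), Real.zero_rpow (by linarith)]
    simp
  · have h1 := mul_le_mul_of_nonneg_left
      (rpow_tangent_le (t := p ^ (r - 1)) (by positivity) hc hq1) hp
    rw [← Real.rpow_mul hp, show (r - 1) * q = m - 1 by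
      rw [hq]; field_simp [(by linarith : r - 1 ≠ 0)], Real.rpow_sub_one h.ne',
      Real.rpow_sub_one h.ne', mul_div_cancel₀ _ h.ne'] at h1
    refine le_trans (le_of_eq ?_) h1
    field_simp

/-- The von Neumann entropy is at most the logarithm of the dimension. -/
theorem IsDensity.entropy_le (hρ : IsDensity ρ) :
    trFun (fun x => -(x * Real.logb 2 x)) ρ ≤ Real.logb 2 (Fintype.card ι) := by
  have := hρ.nonempty
  have hD : (0 : ℝ) < Fintype.card ι := by exact_mod_cast Fintype.card_pos
  have hl : (0 : ℝ) < Real.log 2 := Real.log_pos (by norm_num)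
  set D : ℝ := (Fintype.card ι : ℝ)
  rw [trFun_eq_sum hρ.1.1]
  -- This is log x ≤ x - 1 at x = 1/(Dp); the correction terms sum to zero because both
  -- distributions have mass one.
  have key : ∀ i, -(hρ.1.1.eigenvalues i * Real.logb 2 (hρ.1.1.eigenvalues i)) ≤
      hρ.1.1.eigenvalues i * Real.logb 2 D + (1 / D - hρ.1.1.eigenvalues i) / Real.log 2 := by
    intro i
    have hp := hρ.1.eigenvalues_nonneg i
    set p := hρ.1.1.eigenvalues i
    rcases hp.eq_or_lt with h | h
    · rw [← h]; simp; positivity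
    · have h1 := Real.log_le_sub_one_of_pos (x := 1 / (D * p)) (by positivity)
      rw [Real.log_div one_ne_zero (by positivity), Real.log_mul hD.ne' h.ne', Real.log_one] at h1
      have h2 := mul_le_mul_of_nonneg_left h1 hp
      have e : p * (1 / (D * p) - 1) = 1 / D - p := by field_simp
      rw [e] at h2
      have h3 := div_le_div_of_nonneg_right h2 hl.le
      have e2 : p * (0 - (Real.log D + Real.log p)) / Real.log 2 =
        -(p * Real.logb 2 p) - p * Real.logb 2 D := by
        unfold Real.logb; ring
      rw [e2] at h3
      linarith
  refine (Finset.sum_le_sum fun i _ => key i).trans (le_of_eq ?_)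
  rw [Finset.sum_add_distrib, ← Finset.sum_mul, ← Finset.sum_div, Finset.sum_sub_distrib,
    hρ.sum_eigenvalues, Finset.sum_const, Finset.card_univ, nsmul_eq_mul,
    show (Fintype.card ι : ℝ) * (1 / D) = 1 from mul_one_div_cancel hD.ne']
  simp

theorem logb_le_tangent {x c : ℝ} (hx : 0 < x) (hc : 0 < c) :
    Real.logb 2 x ≤ Real.logb 2 c + (x / c - 1) / Real.log 2 := by
  have h1 := Real.log_le_sub_one_of_pos (x := x / c) (by positivity)
  rw [Real.log_div hx.ne' hc.ne'] at h1
  have h3 := div_le_div_of_nonneg_right h1 (Real.log_pos (by norm_num : (1 : ℝ) < 2)).le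
  rw [sub_div] at h3
  unfold Real.logb
  linarith

/-- Since -log p = (1/(1-m)) log p^(m-1), the tangent to log at `c`, averaged with the eigenvalues
as weights, bounds the entropy below by an expression affine in `trPow m ρ`. -/
theorem IsDensity.le_entropy (hρ : IsDensity ρ) {m c : ℝ} (hm : 1 < m) (hc : 0 < c) :
    1 / (1 - m) * (Real.logb 2 c + (trPow m ρ / c - 1) / Real.log 2) ≤
      trFun (fun x => -(x * Real.logb 2 x)) ρ := by
  rw [trPow, trFun_eq_sum hρ.1.1, trFun_eq_sum hρ.1.1]
  have key : ∀ i, 1 / (1 - m) * (hρ.1.1.eigenvalues i * Real.logb 2 c +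
      (hρ.1.1.eigenvalues i ^ m / c - hρ.1.1.eigenvalues i) / Real.log 2) ≤
      -(hρ.1.1.eigenvalues i * Real.logb 2 (hρ.1.1.eigenvalues i)) := by
    intro i
    have hp := hρ.1.eigenvalues_nonneg i
    set p := hρ.1.1.eigenvalues i
    rcases hp.eq_or_lt with h | h
    · rw [← h, Real.zero_rpow (by linarith)]
      simp
    · have h1 := mul_le_mul_of_nonneg_left
        (logb_le_tangent (x := p ^ (m - 1)) (by positivity) hc) hp
      rw [Real.logb_rpow_eq_mul_logb_of_pos h, Real.rpow_sub_one h.ne'] at h1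
      have h2 : p * Real.logb 2 c + (p ^ m / c - p) / Real.log 2 ≥
          (m - 1) * (p * Real.logb 2 p) := by
        refine ge_iff_le.2 (le_trans (le_of_eq (by ring)) (h1.trans (le_of_eq ?_)))
        field_simp
      have h3 := mul_le_mul_of_nonneg_left h2 (by
        have : 0 < m - 1 := by linarith
        positivity : 0 ≤ 1 / (m - 1))
      have h4 : 1 / (m - 1) * ((m - 1) * (p * Real.logb 2 p)) = p * Real.logb 2 p := by
        field_simp [(by linarith : m - 1 ≠ 0)]
      have h5 : 1 / (1 - m) = -(1 / (m - 1)) := by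
        rw [← neg_sub m 1, div_neg]
      rw [h5]
      rw [h4] at h3
      linarith
  refine le_trans (le_of_eq ?_) (Finset.sum_le_sum fun i _ => key i)
  rw [← Finset.mul_sum, Finset.sum_add_distrib, ← Finset.sum_mul, ← Finset.sum_div,
    Finset.sum_sub_distrib, hρ.sum_eigenvalues, ← Finset.sum_div, one_mul]

end Spectral

open Filter Topology

/-! ### Bounds on moments and average entropies of one channel -/

section Average
variable {ι K : Type*} [Fintype ι] [DecidableEq ι] [Fintype K]
  {C : Mat ι →ₗ[ℂ] Mat ι} {σ X : K → Mat ι}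

theorem PosSemidef.trace_mul_nonneg {M N : Mat ι} (hM : M.PosSemidef) (hN : N.PosSemidef) :
    0 ≤ (M * N).trace := by
  obtain ⟨B, rfl⟩ := PosSemidef.exists_eq_conjTranspose_mul_self hM
  rw [mul_assoc, Matrix.trace_mul_comm]
  exact (hN.mul_mul_conjTranspose_same B).trace_nonneg

theorem IsEntanglementBreaking.isDensity_apply (hC : IsEntanglementBreaking C σ X) {ρ : Mat ι}
    (hρ : IsDensity ρ) : IsDensity (C ρ) := by
  rw [hC.apply_eq]
  refine ⟨Matrix.posSemidef_sum _ fun k _ =>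
    (hC.density k).1.smul (PosSemidef.trace_mul_nonneg (hC.povm.1 k) hρ.1), ?_⟩
  rw [Matrix.trace_sum]
  simp_rw [Matrix.trace_smul, (hC.density _).2, smul_eq_mul, mul_one]
  rw [← Matrix.trace_sum, ← Finset.sum_mul, hC.povm.2, one_mul, hρ.2]

omit [DecidableEq ι] in
theorem isDensity_pureState (φ : UnitSphere ι) : IsDensity (pureState φ) := by
  refine ⟨Matrix.posSemidef_vecMulVec_self_star (φ : EuclideanSpace ℂ ι).ofLp, ?_⟩
  have h := EuclideanSpace.norm_sq_eq (φ : EuclideanSpace ℂ ι)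
  rw [norm_eq_of_mem_sphere, one_pow] at h
  simp only [Matrix.trace, Matrix.diag, pureState, Matrix.of_apply]
  rw [← Complex.ofReal_one, h]
  push_cast
  exact Finset.sum_congr rfl fun a _ => Complex.mul_conj' _

theorem isDensity_maximallyMixed [Nonempty ι] :
    IsDensity ((1 / (Fintype.card ι : ℂ)) • (1 : Mat ι)) := by
  refine ⟨Matrix.PosSemidef.one.smul (by positivity), ?_⟩
  rw [Matrix.trace_smul, Matrix.trace_one, smul_eq_mul]
  exact one_div_mul_cancel (by exact_mod_cast Fintype.card_ne_zero)

omit [DecidableEq ι] in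
theorem continuous_apply_pureState (C : Mat ι →ₗ[ℂ] Mat ι) :
    Continuous fun φ : UnitSphere ι => C (pureState φ) := by
  refine C.continuous_of_finiteDimensional.comp (continuous_matrix fun x y => ?_)
  simp only [pureState, Matrix.of_apply]
  fun_prop

theorem integral_trace_mul_pureState [Nonempty ι] {M : Mat ι} (hM : M.PosSemidef) :
    ∫ φ : UnitSphere ι, (M * pureState φ).trace.re ∂uniform ι =
      M.trace.re / Fintype.card ι := by
  obtain ⟨v, hv⟩ := exists_rank_one_sum hM
  simp_rw [trace_mul_pureState_of_rank_one_sum hv, Complex.ofReal_re]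
  rw [integral_finsetSum _ fun j _ => integrable_of_continuous (by fun_prop),
    trace_of_rank_one_sum hv, Complex.ofReal_re, Finset.sum_div]
  simp_rw [integral_inner_sq]

theorem IsEntanglementBreaking.trace_mul_apply_re (hC : IsEntanglementBreaking C σ X)
    {ρ : Mat ι} (hρ : ρ.PosSemidef) (Y : Mat ι) :
    (C ρ * Y).trace.re = ∑ k, (X k * ρ).trace.re * (σ k * Y).trace.re := by
  rw [hC.apply_eq, Finset.sum_mul, Matrix.trace_sum, Complex.re_sum]
  refine Finset.sum_congr rfl fun k _ => ?_
  rw [Matrix.smul_mul, Matrix.trace_smul, smul_eq_mul, Complex.mul_re,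
    ← (Complex.nonneg_iff.1 (PosSemidef.trace_mul_nonneg (hC.povm.1 k) hρ)).2]
  ring

/-- The mean of |φ⟩⟨φ| is 𝟙/D; testing against `Y` keeps the integrals scalar. -/
theorem IsEntanglementBreaking.integral_trace_mul [Nonempty ι]
    (hC : IsEntanglementBreaking C σ X) (Y : Mat ι) :
    ∫ φ : UnitSphere ι, (C (pureState φ) * Y).trace.re ∂uniform ι =
      (C ((1 / (Fintype.card ι : ℂ)) • 1) * Y).trace.re := by
  have hcont : ∀ k, Continuous fun φ : UnitSphere ι => (X k * pureState φ).trace.re := fun k =>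
    Complex.continuous_re.comp
      (continuous_apply_pureState (LinearMap.mulLeft ℂ (X k))).matrix_trace
  rw [hC.trace_mul_apply_re isDensity_maximallyMixed.1]
  simp_rw [hC.trace_mul_apply_re (isDensity_pureState _).1]
  rw [integral_finsetSum _ fun k _ => integrable_of_continuous ((hcont k).mul_const _)]
  refine Finset.sum_congr rfl fun k _ => ?_
  rw [integral_mul_const, integral_trace_mul_pureState (hC.povm.1 k)]
  congr 1
  rw [Matrix.mul_smul, mul_one, Matrix.trace_smul, smul_eq_mul, one_div, div_eq_inv_mul,
    ← Complex.ofReal_natCast, ← Complex.ofReal_inv, Complex.re_ofReal_mul]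

theorem moment_natCast (hC : IsEntanglementBreaking C σ X) (r : ℕ) :
    moment (r : ℝ) C = ∫ φ : UnitSphere ι, (C (pureState φ) ^ r).trace.re ∂uniform ι := by
  rw [moment]
  simp_rw [trPow_natCast (hC.isDensity_apply (isDensity_pureState _)).1.1]

theorem integrable_trFun [Nonempty ι] (hC : IsEntanglementBreaking C σ X) {f : ℝ → ℝ}
    (hf : ContinuousOn f (Set.Icc 0 1)) :
    Integrable (fun φ : UnitSphere ι => trFun f (C (pureState φ))) (uniform ι) :=
  integrable_of_continuous (continuous_trFun hf (continuous_apply_pureState C) fun φ =>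
    hC.isDensity_apply (isDensity_pureState φ))

theorem integrable_trPow [Nonempty ι] (hC : IsEntanglementBreaking C σ X) {r : ℝ} (hr : 1 ≤ r) :
    Integrable (fun φ : UnitSphere ι => trPow r (C (pureState φ))) (uniform ι) :=
  integrable_trFun hC (continuous_rpow_const (by linarith)).continuousOn

/-- Convexity of `ρ ↦ Tr ρ^r`: the moment is at least its value at the average state. -/
theorem trace_pow_le_moment [Nonempty ι] (hC : IsEntanglementBreaking C σ X) {r : ℕ}
    (hr : 1 ≤ r) :
    (C ((1 / (Fintype.card ι : ℂ)) • 1) ^ r).trace.re ≤ moment (r : ℝ) C := by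
  obtain ⟨n, rfl⟩ := Nat.exists_eq_add_of_le' hr
  set B := C ((1 / (Fintype.card ι : ℂ)) • 1) with hB
  have hBd : IsDensity B := hC.isDensity_apply isDensity_maximallyMixed
  have hi : Integrable (fun φ : UnitSphere ι => (C (pureState φ) ^ (n + 1)).trace.re)
      (uniform ι) :=
    (integrable_trPow hC (r := ((n + 1 : ℕ) : ℝ)) (by exact_mod_cast hr)).congr
      (.of_forall fun φ =>
        trPow_natCast (hC.isDensity_apply (isDensity_pureState φ)).1.1 (n + 1))
  have hc : Continuous fun φ : UnitSphere ι => (C (pureState φ) * B ^ n).trace.re :=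
    Complex.continuous_re.comp (continuous_apply_pureState
      ((LinearMap.mulRight ℂ (B ^ n)).comp C)).matrix_trace
  -- Klein's inequality is taken at the mean output `B`, where the linear term averages to Tr
  -- B^(n+1).
  have h := integral_mono ((integrable_of_continuous hc).const_mul (n + 1 : ℝ))
    (hi.add (integrable_const (n * (B ^ (n + 1)).trace.re))) fun φ =>
      klein_pow (hC.isDensity_apply (isDensity_pureState φ)).1 hBd.1 n
  simp only [Pi.add_apply] at h
  rw [integral_const_mul, hC.integral_trace_mul, integral_add hi (integrable_const _),
    ← moment_natCast hC, ← hB, ← pow_succ'] at h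
  simp only [integral_const, probReal_univ, smul_eq_mul, one_mul] at h
  linarith

/-- Both sides expand over `k` and over rank-one pieces of the POVM with the same weights `t k ≥ 0`,
and are compared term by term. The constant depends only on `r`, so it disappears under
regularization. -/
theorem moment_le_trace_pow [Nonempty ι] (hC : IsEntanglementBreaking C σ X) {r : ℕ}
    (hr : r ≠ 0) (hσ : TraceProdNonneg r σ) :
    moment (r : ℝ) C ≤
      r * r.factorial * (C ((1 / (Fintype.card ι : ℂ)) • 1) ^ r).trace.re := by
  choose v hv using fun k => exists_rank_one_sum (hC.povm.1 k)
  set t : (Fin r → K) → ℝ := fun k => ‖((List.ofFn fun i => σ (k i)).prod).trace‖ with ht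
  have hts : ∀ k : Fin r → K, ((List.ofFn fun i => σ (k i)).prod).trace = ((t k : ℝ) : ℂ) :=
    fun k => (Complex.norm_of_nonneg' (hσ k)).symm
  have e1 : ∀ φ : UnitSphere ι, (C (pureState φ) ^ r).trace.re =
      ∑ k : Fin r → K, t k * ∑ j : Fin r → ι,
        ∏ i, ‖inner ℂ (v (k i) (j i)) (φ : EuclideanSpace ℂ ι)‖ ^ 2 := by
    intro φ
    rw [hC.trace_apply_pow]
    simp_rw [hts, trace_mul_pureState_of_rank_one_sum (hv _)]
    rw [Complex.re_sum]
    refine Finset.sum_congr rfl fun k _ => ?_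
    rw [← Complex.ofReal_prod, ← Complex.ofReal_mul, Complex.ofReal_re, Finset.prod_univ_sum,
      Fintype.piFinset_univ, mul_comm]
  have e2 : (C ((1 / (Fintype.card ι : ℂ)) • 1) ^ r).trace.re =
      ∑ k : Fin r → K, t k * ∑ j : Fin r → ι,
        ((∏ i, ‖v (k i) (j i)‖ ^ 2) * (1 / (Fintype.card ι : ℝ) ^ r)) := by
    rw [hC.trace_apply_pow]
    simp_rw [hts, Matrix.mul_smul, mul_one, Matrix.trace_smul, trace_of_rank_one_sum (hv _),
      smul_eq_mul]
    rw [Complex.re_sum]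
    refine Finset.sum_congr rfl fun k _ => ?_
    rw [← Finset.sum_mul, Finset.prod_mul_distrib, Finset.prod_const, Finset.card_univ,
      Fintype.card_fin, ← Complex.ofReal_prod, ← Complex.ofReal_natCast, ← Complex.ofReal_one,
      ← Complex.ofReal_div, ← Complex.ofReal_pow, ← Complex.ofReal_mul, ← Complex.ofReal_mul,
      Complex.ofReal_re, Finset.prod_univ_sum, Fintype.piFinset_univ, one_div_pow]
    ring
  rw [moment_natCast hC, e2]
  simp_rw [e1]
  rw [integral_finsetSum _ fun k _ => integrable_of_continuous (by fun_prop), Finset.mul_sum]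
  refine Finset.sum_le_sum fun k _ => ?_
  rw [integral_const_mul, integral_finsetSum _ fun j _ => integrable_of_continuous (by fun_prop),
    mul_left_comm]
  refine mul_le_mul_of_nonneg_left ?_ (norm_nonneg ((List.ofFn fun i => σ (k i)).prod).trace)
  rw [Finset.mul_sum]
  refine Finset.sum_le_sum fun j _ => ?_
  refine (integral_prod_inner_sq_le hr fun i => v (k i) (j i)).trans (le_of_eq ?_)
  ring

section Entropy
variable [Nonempty ι] (hC : IsEntanglementBreaking C σ X)
include hC

theorem card_rpow_le_moment {r : ℝ} (hr : 1 ≤ r) :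
    (Fintype.card ι : ℝ) ^ (1 - r) ≤ moment r C := by
  have h := integral_mono (integrable_const ((Fintype.card ι : ℝ) ^ (1 - r)))
    (integrable_trPow hC hr) fun φ =>
      (hC.isDensity_apply (isDensity_pureState φ)).card_rpow_le_trPow hr
  simpa [moment] using h

theorem moment_pos {r : ℝ} (hr : 1 ≤ r) : 0 < moment r C :=
  lt_of_lt_of_le (Real.rpow_pos_of_pos (by exact_mod_cast Fintype.card_pos) _)
    (card_rpow_le_moment hC hr)

omit hC [DecidableEq ι] in
theorem logb_le_logb_card {r x : ℝ} (hr : 1 < r) (hx : (Fintype.card ι : ℝ) ^ (1 - r) ≤ x) :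
    1 / (1 - r) * Real.logb 2 x ≤ Real.logb 2 (Fintype.card ι) := by
  have hD : (0 : ℝ) < Fintype.card ι := by exact_mod_cast Fintype.card_pos
  have h := Real.logb_le_logb_of_le (b := 2) (by norm_num) (by positivity) hx
  rw [Real.logb_rpow_eq_mul_logb_of_pos hD] at h
  have h1 : 1 - r < 0 := by linarith
  have := mul_le_mul_of_nonpos_left h (one_div_nonpos.2 h1.le)
  rwa [← mul_assoc, one_div_mul_cancel h1.ne, one_mul] at this

theorem log_moment_le {r : ℝ} (hr : 1 < r) :
    1 / (1 - r) * Real.logb 2 (moment r C) ≤ Real.logb 2 (Fintype.card ι) :=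
  logb_le_logb_card hr (card_rpow_le_moment hC hr.le)

/-- Jensen's inequality, over eigenvalues and φ together, gives 𝔼 Tr ρ^m ≥ (𝔼 Tr ρ^r)^q with q =
(m-1)/(r-1). -/
theorem log_moment_antitone {r m : ℝ} (hr : 1 < r) (hm : r ≤ m) :
    1 / (1 - m) * Real.logb 2 (moment m C) ≤ 1 / (1 - r) * Real.logb 2 (moment r C) := by
  have hp := moment_pos hC hr.le
  set c := moment r C with hc
  set q := (m - 1) / (r - 1) with hq
  have h := integral_mono
    ((integrable_const (c ^ q * (1 - q))).add
      ((integrable_trPow hC hr.le).const_mul (q * c ^ q / c)))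
    (integrable_trPow hC (hr.le.trans hm)) fun φ =>
      (hC.isDensity_apply (isDensity_pureState φ)).trPow_tangent_le hr hm hp
  simp only [Pi.add_apply] at h
  rw [integral_add (integrable_const _) ((integrable_trPow hC hr.le).const_mul _),
    integral_const_mul (q * c ^ q / c)] at h
  change _ + q * c ^ q / c * moment r C ≤ moment m C at h
  rw [← hc, div_mul_cancel₀ _ hp.ne'] at h
  simp only [integral_const, probReal_univ, smul_eq_mul, one_mul] at h
  -- The integrated tangent line is evaluated at its point of contact `c`, where it equals c^q.
  have h1 : c ^ q ≤ moment m C := by linarith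
  have h2 := Real.logb_le_logb_of_le (b := 2) (by norm_num) (by positivity) h1
  rw [Real.logb_rpow_eq_mul_logb_of_pos hp] at h2
  have h3 := mul_le_mul_of_nonpos_left h2 (one_div_nonpos.2 (by linarith : 1 - m ≤ 0))
  refine h3.trans (le_of_eq ?_)
  rw [hq]
  have a1 : r - 1 ≠ 0 := by linarith
  have a2 : 1 - m ≠ 0 := by linarith
  have a3 : 1 - r ≠ 0 := by linarith
  field_simp
  ring

/-- For r > 1 the lower bound is concavity of log together with monotonicity of the log-moments in
the order. For r = 1 it comes directly from `IsDensity.le_entropy`. Allowing every m ≥ r lets an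
integer order be chosen later. -/
theorem avgEntropy_le {r : ℝ} (hr : 1 ≤ r) :
    avgEntropy r C ≤ Real.logb 2 (Fintype.card ι) ∧
      ∀ m : ℝ, 1 < m → r ≤ m → 1 / (1 - m) * Real.logb 2 (moment m C) ≤ avgEntropy r C := by
  have hd := fun φ : UnitSphere ι => hC.isDensity_apply (isDensity_pureState φ)
  rcases hr.eq_or_lt with rfl | hr1
  · have hi : Integrable (fun φ : UnitSphere ι => renyi 1 (C (pureState φ))) (uniform ι) := by
      simp only [renyi, if_true]
      refine integrable_trFun hC (Continuous.continuousOn ?_)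
      simp_rw [Real.logb, ← mul_div_assoc]
      exact (Real.continuous_mul_log.div_const (Real.log 2)).neg
    constructor
    · have h := integral_mono hi (integrable_const (Real.logb 2 (Fintype.card ι))) fun φ => by
        simpa [renyi] using (hd φ).entropy_le
      simpa [avgEntropy] using h
    · intro m hm _
      have hp := moment_pos hC hm.le
      have hI := (((integrable_trPow hC hm.le).div_const (moment m C)).sub
        (integrable_const (1 : ℝ))).div_const (Real.log 2)
      have h := integral_mono (((integrable_const (Real.logb 2 (moment m C))).add hI).const_mul
        (1 / (1 - m))) hi fun φ => by
          simpa [renyi] using (hd φ).le_entropy hm hp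
      simp only [Pi.add_apply] at h
      rw [integral_const_mul, integral_add (integrable_const _) hI, integral_div] at h
      simp only [Pi.sub_apply] at h
      rw [integral_sub ((integrable_trPow hC hm.le).div_const _) (integrable_const _),
        integral_div] at h
      -- The tangent point is the mean itself, so the linear correction integrates to zero.
      change _ * (_ + (moment m C / moment m C - _) / _) ≤ _ at h
      rw [div_self hp.ne'] at h
      simpa [avgEntropy] using h
  · have hren : ∀ φ : UnitSphere ι, renyi r (C (pureState φ)) =
        1 / (1 - r) * Real.logb 2 (trPow r (C (pureState φ))) := fun φ => by
      rw [renyi, if_neg hr1.ne']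
    have hi : Integrable (fun φ : UnitSphere ι => renyi r (C (pureState φ))) (uniform ι) := by
      simp_rw [hren]
      refine (integrable_of_continuous ?_).const_mul _
      refine Continuous.div_const (Continuous.log ?_ fun φ => ((hd φ).trPow_pos hr).ne') _
      exact continuous_trFun (continuous_rpow_const (by linarith)).continuousOn
        (continuous_apply_pureState C) hd
    constructor
    · have h := integral_mono hi (integrable_const (Real.logb 2 (Fintype.card ι))) fun φ => by
        simp only [hren]
        exact logb_le_logb_card hr1 ((hd φ).card_rpow_le_trPow hr)
      simpa [avgEntropy] using h
    · intro m _ hm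
      refine (log_moment_antitone hC hr1 hm).trans ?_
      have hp := moment_pos hC hr
      have hI := (((integrable_trPow hC hr).div_const (moment r C)).sub
        (integrable_const (1 : ℝ))).div_const (Real.log 2)
      have h := integral_mono (((integrable_const (Real.logb 2 (moment r C))).add hI).const_mul
        (1 / (1 - r))) hi fun φ => by
          simp only [hren, Pi.add_apply, Pi.sub_apply]
          exact mul_le_mul_of_nonpos_left (logb_le_tangent ((hd φ).trPow_pos hr) hp)
            (one_div_nonpos.2 (by linarith))
      simp only [Pi.add_apply] at h
      rw [integral_const_mul, integral_add (integrable_const _) hI, integral_div] at h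
      simp only [Pi.sub_apply] at h
      rw [integral_sub ((integrable_trPow hC hr).div_const _) (integrable_const _),
        integral_div] at h
      change _ * (_ + (moment r C / moment r C - _) / _) ≤ _ at h
      rw [div_self hp.ne'] at h
      simpa [avgEntropy] using h

omit hC [Nonempty ι] in
theorem beta_of_one_lt {r : ℝ} (hr : 1 < r) :
    beta r C = 1 / (1 - r) * Real.logb 2 (moment r C) := by
  rw [beta, if_neg hr.ne']

/-- The log-moments are antitone in the order and bounded by log D, so the right limit at 1 exists
and `limUnder` returns it. -/
theorem tendsto_beta_one :
    Tendsto (fun s : ℝ => beta s C) (𝓝[>] 1) (𝓝 (beta 1 C)) := by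
  have ha : AntitoneOn (fun s : ℝ => 1 / (1 - s) * Real.logb 2 (moment s C)) (Set.Ioi 1) :=
    fun s hs t _ hst => log_moment_antitone hC hs hst
  have hb : BddAbove ((fun s : ℝ => 1 / (1 - s) * Real.logb 2 (moment s C)) '' Set.Ioi 1) :=
    ⟨Real.logb 2 (Fintype.card ι), by
      rintro _ ⟨s, hs, rfl⟩
      exact log_moment_le hC hs⟩
  have h := tendsto_nhds_limUnder ⟨_, ha.tendsto_nhdsGT hb⟩
  rw [beta, if_pos rfl]
  refine h.congr' ?_
  filter_upwards [self_mem_nhdsWithin] with s hs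
  rw [beta_of_one_lt hs]

theorem beta_bounds {r : ℝ} (hr : 1 ≤ r) :
    beta r C ≤ Real.logb 2 (Fintype.card ι) ∧
      ∀ m : ℝ, 1 < m → r ≤ m → 1 / (1 - m) * Real.logb 2 (moment m C) ≤ beta r C := by
  rcases hr.eq_or_lt with rfl | hr1
  · refine ⟨le_of_tendsto (tendsto_beta_one hC) ?_, fun m hm _ =>
      ge_of_tendsto (tendsto_beta_one hC) ?_⟩
    · filter_upwards [self_mem_nhdsWithin] with s hs
      rw [beta_of_one_lt hs]
      exact log_moment_le hC hs
    · filter_upwards [Ioo_mem_nhdsGT hm] with s hs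
      rw [beta_of_one_lt hs.1]
      exact log_moment_antitone hC hs.1 hs.2.le
  · rw [beta_of_one_lt hr1]
    exact ⟨log_moment_le hC hr1, fun m _ hm => log_moment_antitone hC hr1 hm⟩

end Entropy
end Average

/-! ### Limits along tensor powers -/

section Regularization
variable {d : ℕ} {K : Type*} [Fintype K] {A : Mat (Fin d) →ₗ[ℂ] Mat (Fin d)}
  {σ X : K → Mat (Fin d)}

theorem tensorPower_maximallyMixed (A : Mat (Fin d) →ₗ[ℂ] Mat (Fin d)) (n : ℕ) :
    tensorPower A n ((1 / (Fintype.card (Fin n → Fin d) : ℂ)) • 1) =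
      piTensor fun _ => A ((1 / (d : ℂ)) • 1) := by
  simp only [map_smul]
  rw [piTensor_smul, tensorPower_one]
  simp

theorem trace_tensorPower_maximallyMixed_pow (hd : 0 < d) (hA : IsEntanglementBreaking A σ X)
    (n r : ℕ) :
    (tensorPower A n ((1 / (Fintype.card (Fin n → Fin d) : ℂ)) • 1) ^ r).trace.re =
      ((A ((1 / (d : ℂ)) • 1) ^ r).trace.re) ^ n := by
  have : Nonempty (Fin d) := ⟨⟨0, hd⟩⟩
  have hB := hA.isDensity_apply isDensity_maximallyMixed
  rw [Fintype.card_fin] at hB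
  rw [tensorPower_maximallyMixed, piTensor_pow, trace_piTensor, Finset.prod_const,
    Finset.card_univ, Fintype.card_fin, ← PosSemidef.ofReal_re_trace (hB.1.pow r),
    ← Complex.ofReal_pow, Complex.ofReal_re, Complex.ofReal_re]

/-- The moment lies between Tⁿ and r·r!·Tⁿ, and the constant contributes only O(1/n). -/
theorem tendsto_log_moment_div (hd : 0 < d) (hA : IsEntanglementBreaking A σ X) {r : ℕ}
    (hr : 1 ≤ r) (hσ : TraceProdNonneg r σ) :
    Tendsto (fun n : ℕ => 1 / (n : ℝ) * Real.logb 2 (moment (r : ℝ) (tensorPower A n))) atTop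
      (𝓝 (Real.logb 2 (A ((1 / (d : ℂ)) • 1) ^ r).trace.re)) := by
  have : Nonempty (Fin d) := ⟨⟨0, hd⟩⟩
  have hB := hA.isDensity_apply isDensity_maximallyMixed
  rw [Fintype.card_fin] at hB
  set T := (A ((1 / (d : ℂ)) • 1) ^ r).trace.re with hT
  have hTpos : 0 < T := by
    rw [hT, ← trPow_natCast hB.1.1]
    exact hB.trPow_pos (by exact_mod_cast hr)
  set c : ℝ := r * r.factorial with hc
  have hcpos : 0 < c := by
    have : (0 : ℝ) < r := by exact_mod_cast hr
    positivity
  have hlim : Tendsto (fun n : ℕ => Real.logb 2 T + Real.logb 2 c * (1 / (n : ℝ))) atTop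
      (𝓝 (Real.logb 2 T)) := by
    simpa using (tendsto_one_div_atTop_nhds_zero_nat.const_mul (Real.logb 2 c)).const_add
      (Real.logb 2 T)
  refine tendsto_of_tendsto_of_tendsto_of_le_of_le' tendsto_const_nhds hlim ?_ ?_
  · filter_upwards [eventually_gt_atTop 0] with n hn
    have hn' : (0 : ℝ) < n := by exact_mod_cast hn
    have h := trace_pow_le_moment (hA.tensorPower n) hr
    rw [trace_tensorPower_maximallyMixed_pow hd hA, ← hT] at h
    have h1 := Real.logb_le_logb_of_le (b := 2) (by norm_num) (by positivity) h
    rw [Real.logb_pow] at h1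
    rw [one_div, ← div_eq_inv_mul, le_div_iff₀ hn']
    linarith
  · filter_upwards [eventually_gt_atTop 0] with n hn
    have hn' : (0 : ℝ) < n := by exact_mod_cast hn
    have h := moment_le_trace_pow (hA.tensorPower n) (by omega) (hσ.piTensor n)
    rw [trace_tensorPower_maximallyMixed_pow hd hA, ← hT, ← hc] at h
    have h1 := Real.logb_le_logb_of_le (b := 2) (by norm_num)
      (moment_pos (hA.tensorPower n) (by exact_mod_cast hr)) h
    rw [Real.logb_mul hcpos.ne' (by positivity), Real.logb_pow] at h1
    rw [one_div, ← div_eq_inv_mul, div_le_iff₀ hn', add_mul, mul_assoc, inv_mul_cancel₀ hn'.ne']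
    linarith

theorem liminf_coe_eq {u : ℕ → ℝ} {l : ℝ} (h : Tendsto u atTop (𝓝 l)) :
    liminf (fun n => (u n : EReal)) atTop = (l : EReal) :=
  ((continuous_coe_real_ereal.tendsto l).comp h).liminf_eq

/-- The hypothesis on `u` is the common shape of the bounds for the average entropy and for β, so
one squeeze serves both. -/
theorem tendsto_of_unital (hd : 0 < d) (hA : IsEntanglementBreaking A σ X) (hU : A 1 = 1)
    (hσ : ∀ m : ℕ, 2 ≤ m → TraceProdNonneg m σ) {r : ℝ} {u : ℕ → ℝ}
    (hu : ∀ n, u n ≤ Real.logb 2 (Fintype.card (Fin n → Fin d)) ∧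
      ∀ m : ℝ, 1 < m → r ≤ m →
        1 / (1 - m) * Real.logb 2 (moment m (tensorPower A n)) ≤ u n) :
    Tendsto (fun n : ℕ => 1 / (n : ℝ) * u n) atTop (𝓝 (Real.logb 2 (d : ℝ))) := by
  -- The trace condition controls only integer orders at least 2, so the real order `r` is replaced
  -- by an integer above it.
  obtain ⟨m, hm⟩ := exists_nat_ge (max 2 r)
  have hm2 : 2 ≤ m := by exact_mod_cast (le_max_left _ _).trans hm
  have hm1 : (1 : ℝ) < m := by exact_mod_cast hm2
  have hd' : (0 : ℝ) < d := by exact_mod_cast hd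
  have hT : (A ((1 / (d : ℂ)) • 1) ^ m).trace.re = (1 / (d : ℝ)) ^ m * d := by
    rw [map_smul, hU, smul_pow, one_pow, Matrix.trace_smul, Matrix.trace_one, Fintype.card_fin,
      smul_eq_mul, ← Complex.ofReal_natCast, ← Complex.ofReal_one, ← Complex.ofReal_div,
      ← Complex.ofReal_pow, ← Complex.ofReal_mul, Complex.ofReal_re]
  -- Unitality gives Tr A(𝟙/d)^m = d^(1-m), so the lower bound has the same limit log d for every m.
  have hlog : 1 / (1 - (m : ℝ)) * Real.logb 2 (A ((1 / (d : ℂ)) • 1) ^ m).trace.re =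
      Real.logb 2 d := by
    rw [hT, Real.logb_mul (by positivity) hd'.ne', Real.logb_pow, one_div (d : ℝ), Real.logb_inv]
    have : 1 - (m : ℝ) ≠ 0 := by linarith
    field_simp
    ring
  have h := (tendsto_log_moment_div hd hA (by omega) (hσ m hm2)).const_mul (1 / (1 - (m : ℝ)))
  rw [hlog] at h
  refine tendsto_of_tendsto_of_tendsto_of_le_of_le' h tendsto_const_nhds ?_ ?_
  · refine .of_forall fun n => ?_
    rw [mul_left_comm]
    exact mul_le_mul_of_nonneg_left ((hu n).2 m hm1 ((le_max_right _ _).trans hm))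
      (by positivity)
  · filter_upwards [eventually_gt_atTop 0] with n hn
    have hn' : (0 : ℝ) < n := by exact_mod_cast hn
    have h1 := (hu n).1
    rw [Fintype.card_fun, Fintype.card_fin, Fintype.card_fin, Nat.cast_pow, Real.logb_pow] at h1
    rw [one_div, ← div_eq_inv_mul, div_le_iff₀ hn']
    linarith

end Regularization

end AvgOutputEntropy
end

/-! ### The theorem assembled -/

theorem theorem1 {d : ℕ} (hd : 0 < d) {K : Type*} [Fintype K]
    (A : AvgOutputEntropy.Mat (Fin d) →ₗ[ℂ] AvgOutputEntropy.Mat (Fin d))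
    (σ X : K → AvgOutputEntropy.Mat (Fin d))
    (hA : AvgOutputEntropy.IsEntanglementBreaking A σ X) :
    (∀ r : ℕ, 2 ≤ r → AvgOutputEntropy.TraceProdNonneg r σ →
      AvgOutputEntropy.betaReg (r : ℝ) A =
          ((1 / (1 - (r : ℝ)) * Real.logb 2 (A ((1 / (d : ℂ)) • 1) ^ r).trace.re : ℝ) : EReal) ∧
        Filter.Tendsto
          (fun n : ℕ => 1 / (n : ℝ) *
            AvgOutputEntropy.beta (r : ℝ) (AvgOutputEntropy.tensorPower A n))
          Filter.atTop
          (nhds (1 / (1 - (r : ℝ)) * Real.logb 2 (A ((1 / (d : ℂ)) • 1) ^ r).trace.re)) ∧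
        AvgOutputEntropy.Q A r 1 = (A 1 ^ r).trace ∧
        ∀ α : Equiv.Perm (Fin r),
          ((‖AvgOutputEntropy.Q A r α‖ : ℝ) : ℂ) ≤ AvgOutputEntropy.Q A r 1) ∧
    (A 1 = 1 → (∀ m : ℕ, 2 ≤ m → AvgOutputEntropy.TraceProdNonneg m σ) →
      (∀ r : ℝ, 1 ≤ r →
        AvgOutputEntropy.avgEntropyReg r A = ((Real.logb 2 (d : ℝ) : ℝ) : EReal) ∧
        AvgOutputEntropy.betaReg r A = ((Real.logb 2 (d : ℝ) : ℝ) : EReal)) ∧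
      ∀ n : ℕ, Filter.Tendsto
        (fun s : ℝ => AvgOutputEntropy.beta s (AvgOutputEntropy.tensorPower A n))
        (nhdsWithin 1 (Set.Ioi 1))
        (nhds (AvgOutputEntropy.beta 1 (AvgOutputEntropy.tensorPower A n)))) := by
  have : Nonempty (Fin d) := ⟨⟨0, hd⟩⟩
  refine ⟨fun r hr hσ => ?_, fun hU hσ => ⟨fun r hr => ⟨?_, ?_⟩, fun n =>
    AvgOutputEntropy.tendsto_beta_one (hA.tensorPower n)⟩⟩
  · have h : Filter.Tendsto (fun n : ℕ => 1 / (n : ℝ) *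
        AvgOutputEntropy.beta (r : ℝ) (AvgOutputEntropy.tensorPower A n)) Filter.atTop
        (nhds (1 / (1 - (r : ℝ)) * Real.logb 2 (A ((1 / (d : ℂ)) • 1) ^ r).trace.re)) := by
      have hr1 : (1 : ℝ) < r := by exact_mod_cast hr
      refine ((AvgOutputEntropy.tendsto_log_moment_div hd hA (by omega) hσ).const_mul
        (1 / (1 - (r : ℝ)))).congr fun n => ?_
      rw [AvgOutputEntropy.beta_of_one_lt hr1, mul_left_comm]
    exact ⟨AvgOutputEntropy.liminf_coe_eq h, h, AvgOutputEntropy.Q_one A r,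
      AvgOutputEntropy.norm_Q_le hA hσ⟩
  · exact AvgOutputEntropy.liminf_coe_eq (AvgOutputEntropy.tendsto_of_unital hd hA hU hσ
      fun n => AvgOutputEntropy.avgEntropy_le (hA.tensorPower n) hr)
  · exact AvgOutputEntropy.liminf_coe_eq (AvgOutputEntropy.tendsto_of_unital hd hA hU hσ
      fun n => AvgOutputEntropy.beta_bounds (hA.tensorPower n) hr)
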